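/- **Theorem (uniform remainder bound for subsample quantiles with multiple change-points).** Fix $q\in(0,1)$, an integer $m\ge 0$, and constants $c_0,c_1,c_2,c_3,C>0$ and $\lambda>18/5$. For a function $G:\mathbb R\to\mathbb R$ put $\theta(G)=\inf\{x: G(x)\ge q\}$ (the $q$-quantile when $G$ is a CDF). For each sample size $n$ (large enough) let $0=k_0<k_1<\dots<k_m<k_{m+1}=n$ be integers (the change-points), let $\{Y^{(i)}_t\}_{t\in\mathbb Z}$, $i=1,\dots,m+1$, be strictly stationary real time series on a common probability space, with marginal CDF $F^{(i)}$, density $f^{(i)}$ and $\theta_i=\theta(F^{(i)})$, and let the data be $Y_t=Y_t^{(i)}$ for $k_{i-1}<t\le k_i$. The probability space, the $k_i$, the series, $F^{(i)}$ and $f^{(i)}$ may all depend on $n$; $q$, $m$ and the constants do not. Suppose that for all large $n$: 1. the data $Y_1,\dots,Y_n$ are $\alpha$-mixing with coefficients $\alpha(l)\le e^{-c_0 l}$, $l\ge1$, where $\alpha(l)=\sup_{j}\sup\{|P(A\cap B)-P(A)P(B)|: A\in\sigma(Y_1,\dots,Y_j),\ B\in\sigma(Y_{j+l},\dots,Y_n)\}$;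 2. the densities are differentiable and, for every $i$, $\sup_x f^{(i)}(x)\le c_1$, $f^{(i)}(x)\ge c_2$ for $x\in[\min_j\theta_j,\max_j\theta_j]$, and $\sup_x|f^{(i)\prime}(x)|\le c_3$; 3. $\max_i P(|Y_t^{(i)}|>x)\le Cx^{-\lambda}$ for all $x>0$ and all $t$. For $1\le a<b\le n$ let $\omega_{a,b}^{(i)}$ be the proportion of indices $t\in\{a,\dots,b\}$ with $k_{i-1}<t\le k_i$, let $F^{\omega_{a,b}}=\sum_i\omega_{a,b}^{(i)}F^{(i)}$, $f^{\omega_{a,b}}=\sum_i\omega_{a,b}^{(i)}f^{(i)}$, $\theta_{a,b}=\theta(F^{\omega_{a,b}})$, let $\hat\theta_{a,b}=\theta(\hat F_{a,b})$, where $\hat F_{a,b}$ is the empirical CDF of $Y_a,\dots,Y_b$, put $$\xi_i(y,\omega_{a,b})=\frac{F^{(i)}(\theta_{a,b})-\mathbf 1(y\le\theta_{a,b})}{f^{\omega_{a,b}}(\theta_{a,b})},$$ and define the remainder $r_{a,b}$ by $$\hat\theta_{a,b}=\theta_{a,b}+\frac1{b-a+1}\sum_{i=1}^{m+1}\ \sum_{\substack{a\le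 t\le b\\ k_{i-1}<t\le k_i}}\xi_i(Y_t^{(i)},\omega_{a,b})+r_{a,b}.$$ Then: (a) for all large $n$, all $1\le a<b\le n$, all $i$ and all $y\ne\theta_{a,b}$, $\xi_i(y,\omega_{a,b})$ is the Gâteaux derivative of the quantile functional at $F^{\omega_{a,b}}$ in the direction $\delta_y-F^{(i)}$, that is, $$\xi_i(y,\omega_{a,b})=\lim_{\zeta\to0}\zeta^{-1}\big[\theta\big((\delta_y-F^{(i)})\zeta+F^{\omega_{a,b}}\big)-\theta(F^{\omega_{a,b}})\big],$$ where $\delta_y$ stands for the CDF $x\mapsto\mathbf 1(y\le x)$; (b) $\displaystyle \sup_{1\le a<b\le n}\big|(b-a+1)\,r_{a,b}\big|=o_p(n^{1/2})$ as $n\to\infty$. -/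

import Mathlib

open MeasureTheory Filter Topology ProbabilityTheory

noncomputable section

namespace QuantileCP

/-! ### Probabilistic vocabulary -/

/-- Strict stationarity of a two-sided real time series: the law of the whole path is invariant
under every time shift. -/
def IsStationary {Ω : Type*} [MeasurableSpace Ω] (P : Measure Ω) (Z : ℤ → Ω → ℝ) : Prop :=
  ∀ h : ℤ, P.map (fun ω t => Z (t + h) ω) = P.map (fun ω t => Z t ω)

/-- The `σ`-algebra generated by the variables `X_t`, `t ∈ S`. -/
abbrev sigmaOf {Ω : Type*} (X : ℕ → Ω → ℝ) (S : Set ℕ) : MeasurableSpace Ω :=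
  ⨆ t ∈ S, MeasurableSpace.comap (X t) inferInstance

/-- The values `|P(A ∩ B) - P(A) P(B)|` whose supremum is the strong mixing coefficient at lag `l`
of the data `X_1, …, X_n`: here `A` ranges over the past `σ(X_1, …, X_j)` and `B` over the future
`σ(X_{j+l}, …, X_n)`, for all admissible `j`. -/
def alphaSet {Ω : Type*} [MeasurableSpace Ω] (P : Measure Ω) (X : ℕ → Ω → ℝ) (n l : ℕ) : Set ℝ :=
  {r | ∃ j : ℕ, 1 ≤ j ∧ j + l ≤ n ∧ ∃ A B : Set Ω,
    MeasurableSet[sigmaOf X (Set.Icc 1 j)] A ∧ MeasurableSet[sigmaOf X (Set.Icc (j + l) n)] B ∧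
    r = |P.real (A ∩ B) - P.real A * P.real B|}

/-- The strong (`α`-) mixing coefficient at lag `l` of the data `X_1, …, X_n`. -/
def alphaCoef {Ω : Type*} [MeasurableSpace Ω] (P : Measure Ω) (X : ℕ → Ω → ℝ) (n l : ℕ) : ℝ :=
  sSup (alphaSet P X n l)

/-- The supremum in the mixing coefficient is over a bounded set. -/
theorem alphaSet_bddAbove {Ω : Type*} [MeasurableSpace Ω] (P : Measure Ω) [IsProbabilityMeasure P]
    (X : ℕ → Ω → ℝ) (n l : ℕ) : BddAbove (alphaSet P X n l) := by
  refine ⟨1, ?_⟩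
  rintro r ⟨j, -, -, A, B, -, -, rfl⟩
  have hA : P.real A ≤ 1 := measureReal_le_one
  have hB : P.real B ≤ 1 := measureReal_le_one
  have hAB : P.real (A ∩ B) ≤ 1 := measureReal_le_one
  have hA0 : 0 ≤ P.real A := measureReal_nonneg
  have hB0 : 0 ≤ P.real B := measureReal_nonneg
  have hAB0 : 0 ≤ P.real (A ∩ B) := measureReal_nonneg
  rw [abs_le]
  constructor <;> nlinarith

/-! ### The quantile functional, mixtures and empirical distribution functions -/

/-- The `q`-quantile `G⁻¹(q) = inf {x : G(x) ≥ q}`. -/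
def quantile (q : ℝ) (G : ℝ → ℝ) : ℝ := sInf {x | q ≤ G x}

/-- The mixture `∑ i, w_i G_i` of finitely many functions (used for CDFs and for densities). -/
def mixture {m : ℕ} (w : Fin (m + 1) → ℝ) (G : Fin (m + 1) → ℝ → ℝ) (x : ℝ) : ℝ :=
  ∑ i, w i * G i x

/-- The empirical CDF of `x_a, …, x_b`. -/
def empiricalCDF (x : ℕ → ℝ) (a b : ℕ) (y : ℝ) : ℝ :=
  (∑ t ∈ Finset.Icc a b, if x t ≤ y then (1 : ℝ) else 0) / ((b : ℝ) - a + 1)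

/-! ### Piecewise stationary data -/

/-- The time points of the window `{a, …, b}` lying in segment `i`. The change-points are
`k 0 = 0 < k 1 < ⋯ < k (m + 1) = n` and, with `i` counted from `0`, segment `i` is
`{k i + 1, …, k (i + 1)}`. -/
def segWindow {m : ℕ} (k : Fin (m + 2) → ℕ) (a b : ℕ) (i : Fin (m + 1)) : Finset ℕ :=
  Finset.Icc a b ∩ Finset.Ioc (k i.castSucc) (k i.succ)

/-- The proportion of segment `i` in the window `{a, …, b}`. -/
def weight {m : ℕ} (k : Fin (m + 2) → ℕ) (a b : ℕ) (i : Fin (m + 1)) : ℝ :=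
  ((segWindow k a b i).card : ℝ) / ((b : ℝ) - a + 1)

/-- The data `X_1, …, X_n` with `m` change-points: the `i`-th segment of the data is taken from
the stationary series `Y i`. -/
structure IsPiecewiseStationary {Ω : Type*} [MeasurableSpace Ω] (P : Measure Ω) {m : ℕ} (n : ℕ)
    (k : Fin (m + 2) → ℕ) (Y : Fin (m + 1) → ℤ → Ω → ℝ) (X : ℕ → Ω → ℝ) : Prop where
  k_first : k 0 = 0
  k_last : k (Fin.last (m + 1)) = n
  k_strictMono : StrictMono k
  measurable : ∀ i t, Measurable (Y i t)
  stationary : ∀ i, IsStationary P (Y i)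
  data_eq : ∀ (i : Fin (m + 1)) (t : ℕ), k i.castSucc < t → t ≤ k i.succ → X t = Y i (t : ℤ)

/-- The marginal CDF of the stationary series `Y i`. -/
def segCDF {Ω : Type*} [MeasurableSpace Ω] (P : Measure Ω) {m : ℕ}
    (Y : Fin (m + 1) → ℤ → Ω → ℝ) (i : Fin (m + 1)) (x : ℝ) : ℝ :=
  cdf (P.map (Y i 0)) x

/-- `f i` is a probability density of the marginal law of `Y i`; the densities are bounded by
`c₁`, they are at least `c₂` between the smallest and the largest of the segment quantiles, and
they are differentiable with derivative bounded by `c₃`. -/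
structure DensityCondition {Ω : Type*} [MeasurableSpace Ω] (P : Measure Ω) {m : ℕ} (q : ℝ)
    (Y : Fin (m + 1) → ℤ → Ω → ℝ) (f : Fin (m + 1) → ℝ → ℝ) (c₁ c₂ c₃ : ℝ) : Prop where
  nonneg : ∀ i x, 0 ≤ f i x
  density : ∀ i, P.map (Y i 0) = volume.withDensity (fun x => ENNReal.ofReal (f i x))
  le_upper : ∀ i x, f i x ≤ c₁
  lower_le : ∀ i, ∀ x ∈ Set.Icc (⨅ j, quantile q (segCDF P Y j)) (⨆ j, quantile q (segCDF P Y j)),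
    c₂ ≤ f i x
  differentiable : ∀ i, Differentiable ℝ (f i)
  deriv_le : ∀ i x, |deriv (f i) x| ≤ c₃

/-- The polynomial tail bound `max_i P(|Y_t^{(i)}| > x) ≤ C x^{-lam}` for `x > 0`. -/
def TailCondition {Ω : Type*} [MeasurableSpace Ω] (P : Measure Ω) {m : ℕ}
    (Y : Fin (m + 1) → ℤ → Ω → ℝ) (C lam : ℝ) : Prop :=
  ∀ i t, ∀ x : ℝ, 0 < x → P.real {ω | x < |Y i t ω|} ≤ C * x ^ (-lam)

/-! ### The partial-influence expansion of subsample quantiles -/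

/-- The partial influence function
`ξ_i(y, w) = (F_i(θ) - 1(y ≤ θ)) / f^w(θ)` with `θ = θ(F^w)` the `q`-quantile of the mixture. -/
def partialInfluence {m : ℕ} (q : ℝ) (F f : Fin (m + 1) → ℝ → ℝ) (w : Fin (m + 1) → ℝ)
    (i : Fin (m + 1)) (y : ℝ) : ℝ :=
  (F i (quantile q (mixture w F)) - if y ≤ quantile q (mixture w F) then (1 : ℝ) else 0) /
    mixture w f (quantile q (mixture w F))

/-- `D` is the Gâteaux derivative of the `q`-quantile functional at the mixture `F^w` in the
direction `δ_y - F_i`. -/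
def IsGateauxDeriv {m : ℕ} (q : ℝ) (F : Fin (m + 1) → ℝ → ℝ) (w : Fin (m + 1) → ℝ)
    (i : Fin (m + 1)) (y D : ℝ) : Prop :=
  HasDerivAt (fun ζ : ℝ => quantile q
    (fun x => ((if y ≤ x then (1 : ℝ) else 0) - F i x) * ζ + mixture w F x)) D 0

/-- The linear term
`(b - a + 1)⁻¹ ∑ i, ∑ t ∈ {a, …, b} ∩ segment i, ξ_i(Y_t^{(i)}, ω_{a,b})`, for data `x`. -/
def influenceMean {m : ℕ} (q : ℝ) (k : Fin (m + 2) → ℕ) (F f : Fin (m + 1) → ℝ → ℝ)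
    (x : ℕ → ℝ) (a b : ℕ) : ℝ :=
  (∑ i, ∑ t ∈ segWindow k a b i, partialInfluence q F f (weight k a b) i (x t)) /
    ((b : ℝ) - a + 1)

/-- The remainder `r_{a,b}` of the expansion: sample quantile of `x_a, …, x_b` minus the quantile
of the mixture `F^{ω_{a,b}}` minus the linear term. -/
def remainder {m : ℕ} (q : ℝ) (k : Fin (m + 2) → ℕ) (F f : Fin (m + 1) → ℝ → ℝ)
    (x : ℕ → ℝ) (a b : ℕ) : ℝ :=
  quantile q (empiricalCDF x a b) - quantile q (mixture (weight k a b) F) -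
    influenceMean q k F f x a b

/-- `sup_{1 ≤ a < b ≤ n} |(b - a + 1) r_{a,b}|` (a supremum over finitely many windows). -/
def supRemainder {m : ℕ} (q : ℝ) (n : ℕ) (k : Fin (m + 2) → ℕ) (F f : Fin (m + 1) → ℝ → ℝ)
    (x : ℕ → ℝ) : ℝ :=
  ⨆ p : {p : ℕ × ℕ // 1 ≤ p.1 ∧ p.1 < p.2 ∧ p.2 ≤ n},
    |((p.1.2 : ℝ) - p.1.1 + 1) * remainder q k F f x p.1.1 p.1.2|

/-- `Z_n = o_p(s_n)` for real random variables `Z_n`, each on its own probability space, and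
positive scales `s_n`. -/
def IsLittleOp {Ω : ℕ → Type*} [∀ n, MeasurableSpace (Ω n)] (P : ∀ n, Measure (Ω n))
    (Z : ∀ n, Ω n → ℝ) (s : ℕ → ℝ) : Prop :=
  ∀ ε : ℝ, 0 < ε → Tendsto (fun n => P n {ω | ε * s n < |Z n ω|}) atTop (𝓝 0)

end QuantileCP

end

/-! Write `N = b - a + 1`, `F`, `f` and `θ` for the mixture CDF, its density and its quantile, and
`F̂` for the empirical CDF of the window. Summing the influence functions gives `N r = N (θ̂ - θ) +
N (F̂ θ - F θ) / f θ`, so (b) is a Bahadur expansion uniform over windows.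

The expansion itself is deterministic (`abs_bahadur_le`). If `F̂ - F` varies little between `θ` and
the points of a fine grid on `[θ - δ, θ + δ]`, then `θ̂` lies between two neighbouring grid points,
and a Taylor expansion of `F` there leaves three errors: the oscillation of `N (F̂ - F)`, the
curvature `N δ²` and the mesh.

The probability enters through `eventually_centeredCount_tail`: the centred number of visits to a
set of probability at most `v` exceeds `n^ε √(1 + N v)` with probability below any prescribed power
of `n`. Splitting the window into residue classes modulo `L ≈ n^(ε/2)` makes neighbouring summands
of a class nearly independent, with an error exponentially small in `L`; high even moments then grow
as for independent variables, and Markov's inequality applies. Only `n²` windows and polynomially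
many grid points occur, so a union bound suffices.

With `u = n^(1/40)`, windows with `N ≤ u^6` are handled crudely: all data are at most `u^12` in size
off an event of probability `O(n^(1 - 3 lam / 10))`, so `N r = O(u^18)`. Longer windows use `δ = u²
/ √N` and mesh `δ / K` with `K ≥ u³`, and the errors are `O(u^12)`, `O(u^4)` and `O(u^19)`. All are
of smaller order than `√n = u^20`.

For (a), the mixture has slope at least `c₂` at `θ`, and the jump of the perturbation at `y ≠ θ`
stays away from `θ`. The perturbed function therefore crosses level `q` within `O(ζ²)` of the
first-order prediction (`hasDerivAt_quantile_perturbed`). -/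

namespace QuantileCP

/-! ### Covariances, moments and concentration under mixing. -/

/-- Covariance inequality for an event `B` and a bounded variable `U` measurable with respect to a
`σ`-algebra from which `B` is `α`-mixing. -/
theorem abs_integral_mul_indicator_sub_le {Ω : Type*} {m m0 : MeasurableSpace Ω} (hm : m ≤ m0)
    (P : Measure[m0] Ω) [IsProbabilityMeasure P] {B : Set Ω} (hB : MeasurableSet[m0] B) {α R : ℝ}
    (hα : ∀ A, MeasurableSet[m] A → |P.real (A ∩ B) - P.real A * P.real B| ≤ α)
    {U : Ω → ℝ} (hU : Measurable[m] U) (hUR : ∀ ω, |U ω| ≤ R) :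
    |∫ ω, U ω * B.indicator 1 ω ∂P - (∫ ω, U ω ∂P) * P.real B| ≤ 2 * α * R := by
  classical
  have hR : 0 ≤ R := by
    obtain ⟨ω⟩ := nonempty_of_isProbabilityMeasure P
    exact (abs_nonneg _).trans (hUR ω)
  have hiB : Integrable (B.indicator (1 : Ω → ℝ)) P := (integrable_const (1 : ℝ)).indicator hB
  set g : Ω → ℝ := P[B.indicator (1 : Ω → ℝ)|m] with hg
  have hgm : Measurable[m] g := stronglyMeasurable_condExp.measurable
  have hgi : Integrable g P := integrable_condExp
  set h : Ω → ℝ := fun ω => g ω - P.real B with hh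
  have hhm : Measurable[m] h := hgm.sub_const _
  have hhi : Integrable h P := hgi.sub (integrable_const _)
  have hU0 : Measurable U := hU.mono hm le_rfl
  have hUi : Integrable U P := Integrable.of_bound hU0.aestronglyMeasurable R
    (Eventually.of_forall hUR)
  have hUB : Integrable (fun ω => U ω * B.indicator 1 ω) P :=
    hiB.bdd_mul hU0.aestronglyMeasurable (Eventually.of_forall hUR)
  have hUg : Integrable (fun ω => U ω * g ω) P :=
    hgi.bdd_mul hU0.aestronglyMeasurable (Eventually.of_forall hUR)
  have hUh : Integrable (fun ω => U ω * h ω) P :=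
    hhi.bdd_mul hU0.aestronglyMeasurable (Eventually.of_forall hUR)
  -- Since `U` is `m`-measurable, the indicator of `B` may be replaced by its conditional
  -- expectation `g`.
  have key : ∫ ω, U ω * B.indicator 1 ω ∂P = ∫ ω, U ω * g ω ∂P := by
    have h1 := condExp_mul_of_stronglyMeasurable_left (m := m) (μ := P) (f := U)
      (g := B.indicator (1 : Ω → ℝ)) hU.stronglyMeasurable hUB hiB
    calc ∫ ω, U ω * B.indicator 1 ω ∂P = ∫ ω, (P[U * B.indicator (1 : Ω → ℝ)|m]) ω ∂P :=
          (integral_condExp hm).symm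
      _ = _ := integral_congr_ae h1
  have hset : ∀ A, MeasurableSet[m] A → |∫ ω in A, h ω ∂P| ≤ α := by
    intro A hA
    have : ∫ ω in A, h ω ∂P = P.real (A ∩ B) - P.real A * P.real B := by
      rw [hh, integral_sub hgi.integrableOn (integrable_const _).integrableOn,
        setIntegral_condExp hm hiB hA, setIntegral_indicator hB]
      simp
    rw [this]; exact hα A hA
  have e1 : ∫ ω, U ω * B.indicator 1 ω ∂P - (∫ ω, U ω ∂P) * P.real B = ∫ ω, U ω * h ω ∂P := by
    rw [key, ← integral_mul_const, ← integral_sub hUg (hUi.mul_const _)]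
    simp [hh, mul_sub]
  -- The two sign sets of `h` lie in `m`, so the mixing bound applies to each; together they give an
  -- `L¹` bound on `h`.
  have hA : MeasurableSet[m] {ω | 0 ≤ h ω} := measurableSet_le measurable_const hhm
  have e2 : ∫ ω, |h ω| ∂P ≤ 2 * α := by
    rw [← integral_add_compl (hm _ hA) hhi.abs]
    have a1 : ∫ ω in {ω | 0 ≤ h ω}, |h ω| ∂P = ∫ ω in {ω | 0 ≤ h ω}, h ω ∂P :=
      setIntegral_congr_fun (hm _ hA) fun ω hω => abs_of_nonneg hω
    have a2 : ∫ ω in {ω | 0 ≤ h ω}ᶜ, |h ω| ∂P = -∫ ω in {ω | 0 ≤ h ω}ᶜ, h ω ∂P := by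
      rw [← integral_neg]
      exact setIntegral_congr_fun (hm _ hA.compl) fun ω hω => abs_of_neg (not_le.mp hω)
    rw [a1, a2]
    have b1 := (abs_le.mp (hset _ hA)).2
    have b2 := (abs_le.mp (hset _ hA.compl)).1
    linarith
  rw [e1]
  calc |∫ ω, U ω * h ω ∂P| ≤ ∫ ω, |U ω * h ω| ∂P := abs_integral_le_integral_abs
    _ ≤ ∫ ω, R * |h ω| ∂P := by
        refine integral_mono hUh.abs (hhi.abs.const_mul _) fun ω => ?_
        simp only [abs_mul]
        exact mul_le_mul_of_nonneg_right (hUR ω) (abs_nonneg _)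
    _ = R * ∫ ω, |h ω| ∂P := integral_const_mul _ _
    _ ≤ R * (2 * α) := mul_le_mul_of_nonneg_left e2 hR
    _ = 2 * α * R := by ring

/-- The constants in the moment bound for nearly independent summands. -/
def momentConst : ℕ → ℝ
  | a => 1 + 2 ^ a * (1 + ∑ b : Fin a, momentConst b)

theorem one_le_momentConst (a : ℕ) : 1 ≤ momentConst a := by
  induction a using Nat.strong_induction_on with
  | _ a ih =>
    rw [momentConst]
    have : 0 ≤ ∑ b : Fin a, momentConst b :=
      Finset.sum_nonneg fun b _ => zero_le_one.trans (ih b b.2)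
    have : (0 : ℝ) ≤ 2 ^ a * (1 + ∑ b : Fin a, momentConst b) := by positivity
    linarith

/-- Moments of a sum of bounded, centred summands each of which is nearly uncorrelated with the
powers of the preceding partial sum. -/
theorem abs_moment_le {Ω : Type*} [MeasurableSpace Ω] (P : Measure Ω) [IsProbabilityMeasure P]
    (Z : ℕ → Ω → ℝ) (hZm : ∀ j, Measurable (Z j)) (hZ1 : ∀ j ω, |Z j ω| ≤ 1)
    (hZ0 : ∀ j, ∫ ω, Z j ω ∂P = 0) {v V β : ℝ} (hv : ∀ j, ∫ ω, Z j ω ^ 2 ∂P ≤ v) (M p : ℕ)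
    (hV1 : 1 ≤ V) (hVM : M * v ≤ V) (hMβ : M * β ≤ 1)
    (hcov : ∀ j < M, ∀ a ≤ p, ∀ i ≤ p,
      |∫ ω, (∑ s ∈ Finset.range j, Z s ω) ^ a * Z j ω ^ i ∂P -
        (∫ ω, (∑ s ∈ Finset.range j, Z s ω) ^ a ∂P) * ∫ ω, Z j ω ^ i ∂P| ≤ β)
    (a : ℕ) (ha : a ≤ p) : ∀ j ≤ M,
      |∫ ω, (∑ s ∈ Finset.range j, Z s ω) ^ a ∂P| ≤ momentConst a * V ^ (a / 2) := by
  induction a using Nat.strong_induction_on with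
  | _ a ih =>
    set T : ℕ → Ω → ℝ := fun j ω => ∑ s ∈ Finset.range j, Z s ω with hT
    have hTm : ∀ j, Measurable (T j) := fun j => Finset.measurable_sum _ fun s _ => hZm s
    have hTb : ∀ j ω, |T j ω| ≤ j := fun j ω => by
      refine (Finset.abs_sum_le_sum_abs _ _).trans ?_
      refine (Finset.sum_le_sum fun s _ => hZ1 s ω).trans ?_
      simp
    have hint : ∀ j c i, Integrable (fun ω => T j ω ^ c * Z j ω ^ i) P := by
      intro j c i
      refine Integrable.of_bound (((hTm j).pow_const c).mul
        ((hZm j).pow_const i)).aestronglyMeasurable ((j : ℝ) ^ c * 1) (Eventually.of_forall ?_)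
      intro ω
      rw [Real.norm_eq_abs, abs_mul, abs_pow, abs_pow]
      exact mul_le_mul (pow_le_pow_left₀ (abs_nonneg _) (hTb j ω) _)
        (pow_le_one₀ (abs_nonneg _) (hZ1 j ω)) (by positivity) (by positivity)
    have hv0 : 0 ≤ v := (integral_nonneg fun ω => sq_nonneg _).trans (hv 0)
    have hZi : ∀ j i, 2 ≤ i → |∫ ω, Z j ω ^ i ∂P| ≤ v := by
      intro j i hi
      refine (abs_integral_le_integral_abs).trans (le_trans ?_ (hv j))
      refine integral_mono_of_nonneg (Eventually.of_forall fun _ => abs_nonneg _) ?_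
        (Eventually.of_forall fun ω => ?_)
      · simpa using hint j 0 2
      · simp only [abs_pow]
        rw [← sq_abs]
        exact pow_le_pow_of_le_one (abs_nonneg _) (hZ1 j ω) hi
    set Q : ℝ := ∑ b : Fin a, momentConst b with hQ
    have hQ0 : 0 ≤ Q := Finset.sum_nonneg fun b _ => zero_le_one.trans (one_le_momentConst b)
    have hV0 : 0 ≤ V := zero_le_one.trans hV1
    -- Terms of the binomial expansion of `(T j + Z j) ^ a`. Near independence costs `β`; the `i =
    -- 1` product vanishes by centring, and for `i ≥ 2` the power of the partial sum drops by at
    -- least two, hence the exponent `a / 2 - 1` of `V`.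
    have hstep : ∀ j < M, ∀ i, 1 ≤ i → i ≤ a →
        |∫ ω, T j ω ^ (a - i) * Z j ω ^ i ∂P| ≤ β + Q * V ^ (a / 2 - 1) * v := by
      intro j hj i hi1 hia
      have hc := hcov j hj (a - i) (by omega) i (by omega)
      have hnn : 0 ≤ Q * V ^ (a / 2 - 1) * v := by positivity
      have tri : |∫ ω, T j ω ^ (a - i) * Z j ω ^ i ∂P| ≤
          β + |(∫ ω, T j ω ^ (a - i) ∂P)| * |∫ ω, Z j ω ^ i ∂P| := by
        rw [← abs_mul]
        have := abs_sub_abs_le_abs_sub (∫ ω, T j ω ^ (a - i) * Z j ω ^ i ∂P)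
          ((∫ ω, T j ω ^ (a - i) ∂P) * ∫ ω, Z j ω ^ i ∂P)
        linarith
      refine tri.trans (add_le_add le_rfl ?_)
      rcases Nat.lt_or_ge 1 i with hi | hi
      · have h1 := ih (a - i) (by omega) (by omega) j hj.le
        have h2 : momentConst (a - i) ≤ Q := by
          have := Finset.single_le_sum (f := fun b : Fin a => momentConst b)
            (fun b _ => zero_le_one.trans (one_le_momentConst b))
            (Finset.mem_univ (⟨a - i, by omega⟩ : Fin a))
          exact this
        have h3 : V ^ ((a - i) / 2) ≤ V ^ (a / 2 - 1) :=
          pow_le_pow_right₀ hV1 (by omega)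
        exact mul_le_mul (h1.trans (mul_le_mul h2 h3 (by positivity) hQ0)) (hZi j i hi)
          (abs_nonneg _) (by positivity)
      · obtain rfl : i = 1 := by omega
        simpa [hZ0 j] using hnn
    rcases Nat.eq_zero_or_pos a with rfl | hapos
    · intro j _
      simpa using one_le_momentConst 0
    have hrec : ∀ j ≤ M, |∫ ω, T j ω ^ a ∂P| ≤ j * (2 ^ a * (β + Q * V ^ (a / 2 - 1) * v)) := by
      intro j
      induction j with
      | zero => intro _; simp [hT, hapos.ne']
      | succ j ihj =>
        intro hj
        have hexp : ∫ ω, T (j + 1) ω ^ a ∂P = ∫ ω, T j ω ^ a ∂P +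
            ∑ i ∈ Finset.range a, (∫ ω, T j ω ^ i * Z j ω ^ (a - i) ∂P) * a.choose i := by
          have : ∀ ω, T (j + 1) ω ^ a =
              ∑ i ∈ Finset.range (a + 1), T j ω ^ i * Z j ω ^ (a - i) * a.choose i := by
            intro ω
            rw [← add_pow, hT]
            simp only [Finset.sum_range_succ]
          simp_rw [this]
          rw [integral_finsetSum _ fun i _ => (hint j i (a - i)).mul_const _,
            Finset.sum_range_succ, add_comm]
          simp [integral_mul_const]
        rw [hexp]
        have hbd : |∑ i ∈ Finset.range a, (∫ ω, T j ω ^ i * Z j ω ^ (a - i) ∂P) * a.choose i| ≤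
            2 ^ a * (β + Q * V ^ (a / 2 - 1) * v) := by
          have hB0 : 0 ≤ β + Q * V ^ (a / 2 - 1) * v :=
            (abs_nonneg _).trans (hstep j (by omega) 1 le_rfl hapos)
          calc _ ≤ ∑ i ∈ Finset.range a, (β + Q * V ^ (a / 2 - 1) * v) * a.choose i := by
                refine (Finset.abs_sum_le_sum_abs _ _).trans (Finset.sum_le_sum fun i hi => ?_)
                have hi := Finset.mem_range.mp hi
                rw [abs_mul, Nat.abs_cast]
                have := hstep j (by omega) (a - i) (by omega) (by omega)
                rw [show a - (a - i) = i by omega] at this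
                exact mul_le_mul_of_nonneg_right this (Nat.cast_nonneg _)
            _ ≤ ∑ i ∈ Finset.range (a + 1), (β + Q * V ^ (a / 2 - 1) * v) * a.choose i :=
                Finset.sum_le_sum_of_subset_of_nonneg (by simp) fun i _ _ => by positivity
            _ = _ := by
                rw [← Finset.mul_sum, mul_comm]
                congr 1
                exact_mod_cast Nat.sum_range_choose a
        push_cast
        have := (abs_add_le (∫ ω, T j ω ^ a ∂P)
          (∑ i ∈ Finset.range a, (∫ ω, T j ω ^ i * Z j ω ^ (a - i) ∂P) * a.choose i)).trans
          (add_le_add (ihj (by omega)) hbd)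
        linarith
    intro j hj
    rcases Nat.eq_zero_or_pos j with rfl | hjpos
    · simp only [Finset.range_zero, Finset.sum_empty, zero_pow hapos.ne', integral_zero, abs_zero]
      have := one_le_momentConst a
      positivity
    have hB0 : 0 ≤ β + Q * V ^ (a / 2 - 1) * v :=
      (abs_nonneg _).trans (hstep 0 (by omega) 1 le_rfl hapos)
    -- For `a = 1` the subtraction in `a / 2 - 1` truncates and the recursion would lose a factor
    -- `V`; the first moment is exactly zero instead.
    rcases Nat.lt_or_ge 1 a with h2 | h2
    · refine (hrec j hj).trans ?_
      have hjM : (j : ℝ) ≤ M := by exact_mod_cast hj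
      refine (mul_le_mul_of_nonneg_right hjM (by positivity)).trans ?_
      have hVp : V ^ (a / 2) = V ^ (a / 2 - 1) * V := by
        rw [← pow_succ]; congr 1; omega
      have hVp1 : 1 ≤ V ^ (a / 2) := one_le_pow₀ hV1
      have h3 : M * v * (Q * V ^ (a / 2 - 1)) ≤ V * (Q * V ^ (a / 2 - 1)) :=
        mul_le_mul_of_nonneg_right hVM (by positivity)
      have h4 : M * (β + Q * V ^ (a / 2 - 1) * v) ≤ (1 + Q) * V ^ (a / 2) := by
        rw [hVp] at hVp1 ⊢; nlinarith
      rw [momentConst]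
      have h5 := mul_le_mul_of_nonneg_left h4 (by positivity : (0 : ℝ) ≤ 2 ^ a)
      calc _ = 2 ^ a * (M * (β + Q * V ^ (a / 2 - 1) * v)) := by ring
        _ ≤ _ := h5
        _ ≤ _ := by nlinarith
    · obtain rfl : a = 1 := by omega
      have h0 : ∫ ω, T j ω ^ 1 ∂P = 0 := by
        simp_rw [pow_one]
        rw [hT, integral_finsetSum _ fun s _ => by simpa using hint s 0 1]
        simp [hZ0]
      rw [h0, abs_zero]
      have := one_le_momentConst 1
      positivity

theorem sum_range_mul_eq (h : ℕ → ℝ) (L M : ℕ) :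
    ∑ s ∈ Finset.range (L * M), h s =
      ∑ r ∈ Finset.range L, ∑ j ∈ Finset.range M, h (r + L * j) := by
  induction M with
  | zero => simp
  | succ M ih =>
    simp_rw [Finset.sum_range_succ _ M, Finset.sum_add_distrib, ← ih, Nat.mul_succ,
      Finset.sum_range_add, add_comm]

/-- Splitting the sum over a window according to residues modulo `L`. -/
theorem sum_Icc_eq_sum_residues (g : ℕ → ℝ) {a b L M : ℕ} (hM : b + 1 - a ≤ L * M) :
    ∑ t ∈ Finset.Icc a b, g t = ∑ r ∈ Finset.range L, ∑ j ∈ Finset.range M,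
      if a + r + L * j ≤ b then g (a + r + L * j) else 0 := by
  have h := sum_range_mul_eq (fun s => if a + s ≤ b then g (a + s) else 0) L M
  simp only [← add_assoc] at h
  rw [← h, ← Finset.sum_subset (Finset.range_subset_range.mpr hM), ← Finset.Ico_add_one_right_eq_Icc,
    Finset.sum_Ico_eq_sum_range]
  · refine Finset.sum_congr rfl fun s hs => ?_
    have := Finset.mem_range.mp hs
    rw [if_pos (by omega)]
  · intro s _ hs
    rw [Finset.mem_range] at hs
    rw [if_neg (by omega)]

/-- The centred number of visits of `X_a, …, X_b` to the set `I`. -/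
noncomputable def centeredCount {Ω : Type*} [MeasurableSpace Ω] (P : Measure Ω) (X : ℕ → Ω → ℝ) (a b : ℕ)
    (I : Set ℝ) (ω : Ω) : ℝ :=
  ∑ t ∈ Finset.Icc a b, ((X t ⁻¹' I).indicator 1 ω - P.real (X t ⁻¹' I))

theorem measurable_centred_sum_pow {Ω : Type*} [MeasurableSpace Ω] (B : ℕ → Set Ω) (w : ℕ → ℝ)
    (j c : ℕ) (hB : ∀ s < j, MeasurableSet (B s)) :
    Measurable fun ω => (∑ s ∈ Finset.range j, ((B s).indicator (1 : Ω → ℝ) ω - w s)) ^ c :=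
  (Finset.measurable_sum _ fun s hs =>
    (measurable_one.indicator (hB s (Finset.mem_range.mp hs))).sub_const _).pow_const c

/-- Tail bound for the partial sums of centred indicators along an arithmetic progression. -/
theorem stride_tail {Ω : Type*} [MeasurableSpace Ω] (P : Measure Ω) [IsProbabilityMeasure P]
    (X : ℕ → Ω → ℝ) {n : ℕ} (hX : ∀ t, 1 ≤ t → t ≤ n → Measurable (X t)) {L : ℕ}
    {α : ℝ} (hα0 : 0 ≤ α) (hα : ∀ r ∈ alphaSet P X n L, r ≤ α) {a b : ℕ} (ha : 1 ≤ a) (hbn : b ≤ n)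
    {I : Set ℝ} (hI : MeasurableSet I) {v : ℝ} (hv0 : 0 ≤ v)
    (hv : ∀ t, 1 ≤ t → t ≤ n → P.real (X t ⁻¹' I) ≤ v) (M p : ℕ) (hM : 1 ≤ M) {V : ℝ} (hV1 : 1 ≤ V)
    (hVM : M * v ≤ V) (hsmall : M * (4 * α * M ^ (2 * p)) ≤ 1) (r : ℕ) {y : ℝ} (hy : 0 < y) :
    P.real {ω | y ≤ |∑ j ∈ Finset.range M, if a + r + L * j ≤ b then
      (X (a + r + L * j) ⁻¹' I).indicator 1 ω - P.real (X (a + r + L * j) ⁻¹' I) else 0|} ≤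
      momentConst (2 * p) * V ^ p / y ^ (2 * p) := by
  classical
  -- Beyond the end of the window the event is empty, so the padded summands vanish.
  set B : ℕ → Set Ω := fun j => if a + r + L * j ≤ b then X (a + r + L * j) ⁻¹' I else ∅ with hB
  set Z : ℕ → Ω → ℝ := fun j ω => (B j).indicator 1 ω - P.real (B j) with hZ
  have hBm : ∀ j, MeasurableSet (B j) := by
    intro j
    simp only [hB]
    split_ifs with h
    · exact hX _ (by omega) (by omega) hI
    · exact MeasurableSet.empty
  have hBv : ∀ j, P.real (B j) ≤ v := by
    intro j
    simp only [hB]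
    split_ifs with h
    · exact hv _ (by omega) (by omega)
    · simpa using hv0
  have hB1 : ∀ j, P.real (B j) ≤ 1 := fun j => measureReal_le_one
  have hB0 : ∀ j, 0 ≤ P.real (B j) := fun j => measureReal_nonneg
  have hind : ∀ j ω, (B j).indicator (1 : Ω → ℝ) ω = 0 ∨ (B j).indicator (1 : Ω → ℝ) ω = 1 := by
    intro j ω
    by_cases h : ω ∈ B j <;> simp [h]
  have hindi : ∀ j, Integrable ((B j).indicator (1 : Ω → ℝ)) P :=
    fun j => (integrable_const (1 : ℝ)).indicator (hBm j)
  have hinti : ∀ j, ∫ ω, (B j).indicator (1 : Ω → ℝ) ω ∂P = P.real (B j) :=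
    fun j => by rw [integral_indicator_one (hBm j)]
  have hZm : ∀ j, Measurable (Z j) := fun j => (measurable_one.indicator (hBm j)).sub_const _
  have hZ1 : ∀ j ω, |Z j ω| ≤ 1 := by
    intro j ω
    have h1 := hB1 j
    have h0 := hB0 j
    simp only [hZ]
    rw [abs_le]
    rcases hind j ω with h | h <;> rw [h] <;> constructor <;> linarith
  have hZ0 : ∀ j, ∫ ω, Z j ω ∂P = 0 := by
    intro j
    simp only [hZ]
    rw [integral_sub (hindi j) (integrable_const _), hinti]
    simp
  -- A power of a centred indicator is affine in the indicator, so all covariances reduce to those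
  -- with the event `B j`.
  have hpow : ∀ j i ω, Z j ω ^ i = (-P.real (B j)) ^ i +
      ((1 - P.real (B j)) ^ i - (-P.real (B j)) ^ i) * (B j).indicator 1 ω := by
    intro j i ω
    simp only [hZ]
    rcases hind j ω with h | h <;> rw [h] <;> ring
  have hZv : ∀ j, ∫ ω, Z j ω ^ 2 ∂P ≤ v := by
    intro j
    simp_rw [hpow]
    rw [integral_add (integrable_const _) ((hindi j).const_mul _), integral_const_mul, hinti]
    simp only [integral_const, probReal_univ, one_smul]
    nlinarith [hB0 j, hB1 j, hBv j]
  have hcov : ∀ j < M, ∀ c ≤ 2 * p, ∀ i ≤ 2 * p,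
      |∫ ω, (∑ s ∈ Finset.range j, Z s ω) ^ c * Z j ω ^ i ∂P -
        (∫ ω, (∑ s ∈ Finset.range j, Z s ω) ^ c ∂P) * ∫ ω, Z j ω ^ i ∂P| ≤
        4 * α * M ^ (2 * p) := by
    intro j hj c hc i _
    have hM1 : (1 : ℝ) ≤ M := by exact_mod_cast hM
    have hRHS : 0 ≤ 4 * α * (M : ℝ) ^ (2 * p) := by positivity
    set U : Ω → ℝ := fun ω => (∑ s ∈ Finset.range j, Z s ω) ^ c with hU
    have hUb : ∀ ω, |U ω| ≤ (M : ℝ) ^ (2 * p) := by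
      intro ω
      have : |∑ s ∈ Finset.range j, Z s ω| ≤ M := by
        refine (Finset.abs_sum_le_sum_abs _ _).trans ?_
        refine (Finset.sum_le_sum fun s _ => hZ1 s ω).trans ?_
        simpa using hj.le
      simp only [hU, abs_pow]
      exact (pow_le_pow_left₀ (abs_nonneg _) this _).trans (pow_le_pow_right₀ hM1 hc)
    have hUm : Measurable U := (Finset.measurable_sum _ fun s _ => hZm s).pow_const c
    have hUi : Integrable U P := Integrable.of_bound hUm.aestronglyMeasurable _
      (Eventually.of_forall hUb)
    have hUB : Integrable (fun ω => U ω * (B j).indicator 1 ω) P :=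
      (hindi j).bdd_mul hUm.aestronglyMeasurable (Eventually.of_forall hUb)
    have hd : |(1 - P.real (B j)) ^ i - (-P.real (B j)) ^ i| ≤ 2 := by
      have h1 : |1 - P.real (B j)| ≤ 1 := by
        rw [abs_le]; constructor <;> linarith [hB0 j, hB1 j]
      have h2 : |-P.real (B j)| ≤ 1 := by
        rw [abs_le]; constructor <;> linarith [hB0 j, hB1 j]
      refine (abs_sub _ _).trans ?_
      rw [abs_pow, abs_pow]
      linarith [pow_le_one₀ (n := i) (abs_nonneg _) h1, pow_le_one₀ (n := i) (abs_nonneg _) h2]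
    have e : ∫ ω, U ω * Z j ω ^ i ∂P - (∫ ω, U ω ∂P) * ∫ ω, Z j ω ^ i ∂P =
        ((1 - P.real (B j)) ^ i - (-P.real (B j)) ^ i) *
          (∫ ω, U ω * (B j).indicator 1 ω ∂P - (∫ ω, U ω ∂P) * P.real (B j)) := by
      simp_rw [hpow]
      have : ∀ ω, U ω * ((-P.real (B j)) ^ i +
          ((1 - P.real (B j)) ^ i - (-P.real (B j)) ^ i) * (B j).indicator 1 ω) =
          U ω * (-P.real (B j)) ^ i +
          ((1 - P.real (B j)) ^ i - (-P.real (B j)) ^ i) * (U ω * (B j).indicator 1 ω) := by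
        intro ω; ring
      simp_rw [this]
      rw [integral_add (hUi.mul_const _) (hUB.const_mul _),
        integral_add (integrable_const _) ((hindi j).const_mul _), integral_const_mul,
        integral_const_mul, integral_mul_const, hinti]
      simp only [integral_const, probReal_univ, one_smul]
      ring
    rw [e, abs_mul]
    have hmain : |∫ ω, U ω * (B j).indicator 1 ω ∂P - (∫ ω, U ω ∂P) * P.real (B j)| ≤
        2 * α * (M : ℝ) ^ (2 * p) := by
      by_cases hb : a + r + L * j ≤ b
      -- At `j = 0` there is no past and `U` is constant. For `j ≥ 1` the partial sum uses times at
      -- least `L` before the current one.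
      · rcases Nat.eq_zero_or_pos j with rfl | hj0
        · have : ∀ ω, U ω = 0 ^ c := fun ω => by simp [hU]
          simp_rw [this]
          rw [integral_const_mul, hinti]
          simp only [integral_const, probReal_univ, one_smul, sub_self, abs_zero]
          positivity
        · have hLj : L ≤ L * j := Nat.le_mul_of_pos_right L hj0
          have hXt : ∀ t, 1 ≤ t → t ≤ n → MeasurableSpace.comap (X t) inferInstance ≤
              (inferInstance : MeasurableSpace Ω) := fun t h1 h2 => (hX t h1 h2).comap_le
          have hm : sigmaOf X (Set.Icc 1 (a + r + L * j - L)) ≤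
              (inferInstance : MeasurableSpace Ω) :=
            iSup₂_le fun t ht => hXt t ht.1 (by have := ht.2; omega)
          refine abs_integral_mul_indicator_sub_le hm P (hBm j) ?_ ?_ hUb
          · intro A hA
            refine hα _ ⟨a + r + L * j - L, by omega, by omega, A, B j, hA, ?_, rfl⟩
            simp only [hB, if_pos hb]
            refine (le_iSup₂_of_le (f := fun t (_ : t ∈ Set.Icc (a + r + L * j - L + L) n) =>
              MeasurableSpace.comap (X t) inferInstance) (a + r + L * j)
              ⟨by omega, by omega⟩ le_rfl) _ ?_
            exact ⟨I, hI, rfl⟩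
          · refine @measurable_centred_sum_pow _ (sigmaOf X (Set.Icc 1 (a + r + L * j - L))) B _ j c
              fun s hs => ?_
            have hs' : L * s + L ≤ L * j := by
              rw [← Nat.mul_succ]
              exact Nat.mul_le_mul_left L hs
            have hsb : a + r + L * s ≤ b := by omega
            simp only [hB, if_pos hsb]
            refine (le_iSup₂_of_le (f := fun t (_ : t ∈ Set.Icc 1 (a + r + L * j - L)) =>
              MeasurableSpace.comap (X t) inferInstance) (a + r + L * s)
              ⟨by omega, by omega⟩ le_rfl) _ ?_
            exact ⟨I, hI, rfl⟩
      · have : B j = ∅ := by simp only [hB, if_neg hb]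
        rw [this]
        simp only [Set.indicator_empty, mul_zero, integral_zero, measureReal_empty,
          sub_self, abs_zero]
        positivity
    calc _ ≤ 2 * (2 * α * (M : ℝ) ^ (2 * p)) := mul_le_mul hd hmain (abs_nonneg _) (by norm_num)
      _ = _ := by ring
  have hmom := abs_moment_le P Z hZm hZ1 hZ0 hZv M (2 * p) hV1 hVM hsmall hcov (2 * p) le_rfl M
    le_rfl
  rw [show 2 * p / 2 = p by omega] at hmom
  have hfun : ∀ ω, (∑ j ∈ Finset.range M, if a + r + L * j ≤ b then
      (X (a + r + L * j) ⁻¹' I).indicator 1 ω - P.real (X (a + r + L * j) ⁻¹' I) else 0) =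
      ∑ j ∈ Finset.range M, Z j ω := by
    intro ω
    refine Finset.sum_congr rfl fun j _ => ?_
    simp only [hZ, hB]
    split_ifs <;> simp
  simp_rw [hfun]
  rw [le_div_iff₀ (by positivity), mul_comm]
  have hTi : Integrable (fun ω => (∑ j ∈ Finset.range M, Z j ω) ^ (2 * p)) P := by
    refine Integrable.of_bound
      ((Finset.measurable_sum _ fun s _ => hZm s).pow_const _).aestronglyMeasurable
      ((M : ℝ) ^ (2 * p)) (Eventually.of_forall fun ω => ?_)
    rw [Real.norm_eq_abs, abs_pow]
    refine pow_le_pow_left₀ (abs_nonneg _) ?_ _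
    refine (Finset.abs_sum_le_sum_abs _ _).trans ?_
    refine (Finset.sum_le_sum fun s _ => hZ1 s ω).trans ?_
    simp
  refine le_trans ?_ ((le_abs_self _).trans hmom)
  refine le_trans ?_ (mul_meas_ge_le_integral_of_nonneg (Eventually.of_forall fun ω =>
    (even_two_mul p).pow_nonneg _) hTi (y ^ (2 * p)))
  refine mul_le_mul_of_nonneg_left (measureReal_mono fun ω hω => ?_) (by positivity)
  simp only [Set.mem_ofPred_eq] at hω ⊢
  rw [← (even_two_mul p).pow_abs (∑ j ∈ Finset.range M, Z j ω)]
  exact pow_le_pow_left₀ hy.le hω _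

/-- Polynomial tail bound for the centred number of visits to a set. -/
theorem centeredCount_tail {Ω : Type*} [MeasurableSpace Ω] (P : Measure Ω) [IsProbabilityMeasure P]
    (X : ℕ → Ω → ℝ) {n : ℕ} (hX : ∀ t, 1 ≤ t → t ≤ n → Measurable (X t)) {L : ℕ} (hL : 1 ≤ L)
    {α : ℝ} (hα0 : 0 ≤ α) (hα : ∀ r ∈ alphaSet P X n L, r ≤ α) {a b : ℕ} (ha : 1 ≤ a) (hab : a ≤ b)
    (hbn : b ≤ n) {I : Set ℝ} (hI : MeasurableSet I) {v : ℝ} (hv0 : 0 ≤ v)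
    (hv : ∀ t, 1 ≤ t → t ≤ n → P.real (X t ⁻¹' I) ≤ v) (p : ℕ) {V : ℝ} (hV1 : 1 ≤ V)
    (hVM : ((b : ℝ) - a + 1) * v ≤ V) (hsmall : (n : ℝ) * (4 * α * (n : ℝ) ^ (2 * p)) ≤ 1)
    {x : ℝ} (hx : 0 < x) :
    P.real {ω | x < |centeredCount P X a b I ω|} ≤
      L * (momentConst (2 * p) * V ^ p / (x / L) ^ (2 * p)) := by
  have hL0 : (0 : ℝ) < L := by exact_mod_cast hL
  have hM1 : 1 ≤ b + 1 - a := by omega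
  have hMc : ((b + 1 - a : ℕ) : ℝ) = (b : ℝ) - a + 1 := by
    rw [Nat.cast_sub (by omega)]; push_cast; ring
  have hMn : ((b + 1 - a : ℕ) : ℝ) ≤ n := by exact_mod_cast (by omega : b + 1 - a ≤ n)
  have hs : ((b + 1 - a : ℕ) : ℝ) * (4 * α * ((b + 1 - a : ℕ) : ℝ) ^ (2 * p)) ≤ 1 := by
    refine le_trans ?_ hsmall
    gcongr
  -- If the total exceeds `x`, one of the `L` residue sums reaches `x / L`. Each is padded to the
  -- full window length, a crude but sufficient count.
  have hsub : {ω | x < |centeredCount P X a b I ω|} ⊆ ⋃ r ∈ Finset.range L,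
      {ω | x / L ≤ |∑ j ∈ Finset.range (b + 1 - a), if a + r + L * j ≤ b then
      (X (a + r + L * j) ⁻¹' I).indicator 1 ω - P.real (X (a + r + L * j) ⁻¹' I) else 0|} := by
    intro ω hω
    by_contra hcon
    simp only [Set.mem_iUnion, Set.mem_ofPred_eq, not_exists, not_le] at hcon hω
    rw [centeredCount, sum_Icc_eq_sum_residues _ (Nat.le_mul_of_pos_left (b + 1 - a) hL)] at hω
    have h1 := hω.trans_le (Finset.abs_sum_le_sum_abs _ _)
    have h2 := h1.trans_le (Finset.sum_le_sum fun r hr => (hcon r hr).le)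
    simp only [Finset.sum_const, Finset.card_range, nsmul_eq_mul] at h2
    rw [mul_div_cancel₀ _ hL0.ne'] at h2
    exact lt_irrefl _ h2
  refine (measureReal_mono hsub (measure_ne_top _ _)).trans ?_
  refine (measureReal_biUnion_finset_le _ _).trans ?_
  refine (Finset.sum_le_sum fun r _ => stride_tail P X hX hα0 hα ha hbn hI hv0 hv (b + 1 - a) p hM1
    hV1 (by rwa [hMc]) hs r (y := x / L) (by positivity)).trans ?_
  simp

/-- An exponentially mixing sequence: the centred numbers of visits to a set of probability at
most `v` during a window of length `N` exceed `n ^ ε √(1 + N v)` with probability smaller than any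
given power of `n`, uniformly over windows and sets. -/
theorem eventually_centeredCount_tail {c₀ : ℝ} (hc₀ : 0 < c₀) {ε : ℝ} (hε : 0 < ε) (A : ℝ) :
    ∀ᶠ n : ℕ in atTop, ∀ {Ω : Type*} [MeasurableSpace Ω] (P : Measure Ω) [IsProbabilityMeasure P]
      (X : ℕ → Ω → ℝ), (∀ t, 1 ≤ t → t ≤ n → Measurable (X t)) →
      (∀ l : ℕ, 1 ≤ l → alphaCoef P X n l ≤ Real.exp (-c₀ * l)) →
      ∀ a b : ℕ, 1 ≤ a → a ≤ b → b ≤ n → ∀ I : Set ℝ, MeasurableSet I → ∀ v : ℝ, 0 ≤ v →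
      (∀ t, 1 ≤ t → t ≤ n → P.real (X t ⁻¹' I) ≤ v) →
      P.real {ω | (n : ℝ) ^ ε * √(1 + ((b : ℝ) - a + 1) * v) < |centeredCount P X a b I ω|} ≤
        (n : ℝ) ^ (-A) := by
  -- With stride `L ≈ n^(ε/2)`, Markov's inequality of order `2 p` yields `D n^(ε/2 - ε p)`. One
  -- further power of `n` absorbs `D`, which explains `A + 1`.
  obtain ⟨p, hp⟩ := exists_nat_gt ((A + 1) / ε + 1 / 2)
  set D : ℝ := 2 ^ (1 + 2 * p) * momentConst (2 * p) with hD
  have hcast : Tendsto (fun n : ℕ => (n : ℝ)) atTop atTop := tendsto_natCast_atTop_atTop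
  have hlog : (fun x : ℝ => x ^ (2 * p + 2 : ℝ)) =o[atTop] fun x : ℝ => Real.exp (c₀ * x ^ (ε / 2)) := by
    have h1 := isLittleO_rpow_exp_pos_mul_atTop ((2 * p + 2) / (ε / 2)) hc₀
    have h2 := h1.comp_tendsto (tendsto_rpow_atTop (half_pos hε))
    refine h2.congr' ?_ (by rfl)
    filter_upwards [eventually_gt_atTop 0] with x hx
    simp only [Function.comp]
    rw [← Real.rpow_mul hx.le]
    congr 1
    field_simp
  have ev1 : ∀ᶠ n : ℕ in atTop, (n : ℝ) ^ (2 * p + 2 : ℝ) ≤ Real.exp (c₀ * (n : ℝ) ^ (ε / 2)) := by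
    filter_upwards [hcast.eventually (hlog.bound one_pos)] with n hn
    rw [one_mul, Real.norm_eq_abs, Real.norm_eq_abs, abs_of_nonneg (by positivity),
      abs_of_nonneg (by positivity)] at hn
    exact hn
  have ev2 : ∀ᶠ n : ℕ in atTop, max 4 D ≤ (n : ℝ) := hcast.eventually_ge_atTop _
  filter_upwards [ev1, ev2] with n h1 h2
  intro Ω _ P _ X hX hmix a b ha hab hbn I hI v hv0 hv
  have h4 : (4 : ℝ) ≤ n := (le_max_left _ _).trans h2
  have hDn : D ≤ n := (le_max_right _ _).trans h2
  have hn0 : (0 : ℝ) < n := by linarith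
  have hn1 : (1 : ℝ) ≤ n := by linarith
  set s : ℝ := (n : ℝ) ^ (ε / 2) with hs
  have hs1 : 1 ≤ s := Real.one_le_rpow hn1 (by positivity)
  have hs0 : 0 < s := by linarith
  set L : ℕ := ⌈s⌉₊ with hL
  have hLs : s ≤ L := Nat.le_ceil _
  have hL2 : (L : ℝ) ≤ 2 * s := by
    have := Nat.ceil_lt_add_one hs0.le
    linarith
  have hL1 : 1 ≤ L := Nat.one_le_ceil_iff.mpr hs0
  have hL0 : (0 : ℝ) < L := by exact_mod_cast hL1
  have hN0 : (0 : ℝ) ≤ (b : ℝ) - a + 1 := by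
    have : (a : ℝ) ≤ b := by exact_mod_cast hab
    linarith
  set V : ℝ := 1 + ((b : ℝ) - a + 1) * v with hV
  have hNv : 0 ≤ ((b : ℝ) - a + 1) * v := mul_nonneg hN0 hv0
  have hV1 : 1 ≤ V := by linarith
  have hV0 : 0 < V := by linarith
  -- Since `L ≥ n^(ε/2)`, the mixing coefficient at lag `L` beats every fixed power of `n`.
  have hsmall : (n : ℝ) * (4 * Real.exp (-c₀ * L) * (n : ℝ) ^ (2 * p)) ≤ 1 := by
    have e1 : Real.exp (-c₀ * L) ≤ (Real.exp (c₀ * s))⁻¹ := by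
      rw [← Real.exp_neg]
      refine Real.exp_le_exp.mpr ?_
      nlinarith
    have e2 : (n : ℝ) ^ (2 * p + 2 : ℝ) = n * n * (n : ℝ) ^ (2 * p) := by
      rw [show (2 * p + 2 : ℝ) = ((2 + 2 * p : ℕ) : ℝ) by push_cast; ring, Real.rpow_natCast, pow_add,
        sq]
    have e3 : (n : ℝ) * (4 * Real.exp (-c₀ * L) * (n : ℝ) ^ (2 * p)) ≤
        n * n * (n : ℝ) ^ (2 * p) * (Real.exp (c₀ * s))⁻¹ := by
      calc _ = (4 * n * (n : ℝ) ^ (2 * p)) * Real.exp (-c₀ * L) := by ring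
        _ ≤ (n * n * (n : ℝ) ^ (2 * p)) * (Real.exp (c₀ * s))⁻¹ := by gcongr
    refine e3.trans ?_
    rw [← e2, ← div_eq_mul_inv]
    exact div_le_one_of_le₀ h1 (Real.exp_pos _).le
  have hx : 0 < (n : ℝ) ^ ε * √V := by positivity
  refine (centeredCount_tail P X hX hL1 (Real.exp_pos _).le
    (fun r hr => (le_csSup (alphaSet_bddAbove P X n L) hr).trans (hmix L hL1)) ha hab hbn hI hv0 hv p
    hV1 (by linarith) hsmall hx).trans ?_
  have hsq : (n : ℝ) ^ ε = s * s := by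
    rw [hs, ← Real.rpow_add hn0]; congr 1; ring
  have e1 : L * (momentConst (2 * p) * V ^ p / ((n : ℝ) ^ ε * √V / L) ^ (2 * p)) =
      momentConst (2 * p) * (L : ℝ) ^ (1 + 2 * p) / s ^ (4 * p) := by
    have : √V ^ (2 * p) = V ^ p := by rw [pow_mul, Real.sq_sqrt hV0.le]
    rw [div_pow, mul_pow, this, hsq, ← sq, ← pow_mul, show 2 * (2 * p) = 4 * p by ring]
    field_simp
    ring
  rw [e1]
  have hmc : 0 ≤ momentConst (2 * p) := zero_le_one.trans (one_le_momentConst _)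
  calc momentConst (2 * p) * (L : ℝ) ^ (1 + 2 * p) / s ^ (4 * p)
      ≤ momentConst (2 * p) * (2 * s) ^ (1 + 2 * p) / s ^ (4 * p) := by gcongr
    _ = D * s ^ ((1 + 2 * p : ℝ) - 4 * p) := by
        rw [mul_pow, Real.rpow_sub hs0, hD,
          show (1 + 2 * p : ℝ) = ((1 + 2 * p : ℕ) : ℝ) by push_cast; ring,
          show (4 * p : ℝ) = ((4 * p : ℕ) : ℝ) by push_cast; ring, Real.rpow_natCast,
          Real.rpow_natCast]
        ring
    _ ≤ n * s ^ ((1 + 2 * p : ℝ) - 4 * p) := by gcongr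
    _ = (n : ℝ) ^ (1 + ε / 2 * ((1 + 2 * p : ℝ) - 4 * p)) := by
        rw [hs, ← Real.rpow_mul hn0.le, Real.rpow_add hn0, Real.rpow_one]
    _ ≤ (n : ℝ) ^ (-A) := by
        refine Real.rpow_le_rpow_of_exponent_le hn1 ?_
        have : (A + 1) < (p - 1 / 2) * ε := by
          rw [← div_lt_iff₀ hε]; linarith
        nlinarith

/-! ### Quantiles of differentiable functions -/

theorem abs_taylor_le {G g : ℝ → ℝ} {c₃ : ℝ} (hc₃ : 0 ≤ c₃) (hG : ∀ x, HasDerivAt G (g x) x)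
    (hg : ∀ x y, |g x - g y| ≤ c₃ * |x - y|) (θ x : ℝ) :
    |G x - G θ - g θ * (x - θ)| ≤ c₃ * (x - θ) ^ 2 := by
  have h := (convex_uIcc θ x).norm_image_sub_le_of_norm_hasDerivWithin_le
    (f := fun z => G z - g θ * z) (f' := fun z => g z - g θ) (C := c₃ * |x - θ|)
    (fun z _ => by simpa using ((hG z).fun_sub ((hasDerivAt_id z).const_mul (g θ))).hasDerivWithinAt)
    (fun z hz => by
      rw [Real.norm_eq_abs]
      exact (hg z θ).trans (mul_le_mul_of_nonneg_left (Set.abs_sub_left_of_mem_uIcc hz) hc₃))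
    Set.left_mem_uIcc Set.right_mem_uIcc
  simp only [Real.norm_eq_abs] at h
  rw [mul_assoc, ← sq, sq_abs] at h
  convert h using 2
  ring

theorem half_slope_le {G g : ℝ → ℝ} {θ c₂ c₃ ρ : ℝ} (hc₃ : 0 ≤ c₃)
    (hG : ∀ x, HasDerivAt G (g x) x) (hg : ∀ x y, |g x - g y| ≤ c₃ * |x - y|) (hgθ : c₂ ≤ g θ)
    (hρ : c₃ * ρ ≤ c₂ / 2) {x y : ℝ} (hx : θ - ρ ≤ x) (hxy : x ≤ y) (hy : y ≤ θ + ρ) :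
    c₂ / 2 * (y - x) ≤ G y - G x := by
  refine (convex_Icc (θ - ρ) (θ + ρ)).mul_sub_le_image_sub_of_le_deriv
    (fun z _ => (hG z).continuousAt.continuousWithinAt)
    (fun z _ => (hG z).differentiableAt.differentiableWithinAt) (fun z hz => ?_) x
    ⟨hx, hxy.trans hy⟩ y ⟨hx.trans hxy, hy⟩ hxy
  rw [(hG z).deriv]
  have hz := interior_subset hz
  have h1 : |z - θ| ≤ ρ := by rw [abs_le]; constructor <;> linarith [hz.1, hz.2]
  have h2 := (abs_le.mp (hg z θ)).1
  nlinarith [mul_le_mul_of_nonneg_left h1 hc₃]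

/-- Monotonicity of `H` is not required: `hl` bounds the superlevel set below, so that its `sInf` is
not the default value `0`. This matters for the perturbed functions in the Gâteaux derivative. -/
theorem quantile_le_of_le {q : ℝ} {H : ℝ → ℝ} {l x : ℝ} (hl : ∀ z < l, H z < q) (hx : q ≤ H x) :
    quantile q H ≤ x :=
  csInf_le ⟨l, fun z hz => not_lt.mp fun h => (hl z h).not_ge hz⟩ hx

theorem le_quantile {q : ℝ} {H : ℝ → ℝ} {l x : ℝ} (hl : ∀ z < l, H z < q) (hx : q ≤ H x) :
    l ≤ quantile q H :=
  le_csInf ⟨x, hx⟩ fun z hz => not_lt.mp fun h => (hl z h).not_ge hz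

/-- The superlevel set is closed, so it contains its infimum. A value above `q` there would let the
intermediate value theorem produce a smaller point of the set. -/
theorem apply_quantile_eq {q : ℝ} {G : ℝ → ℝ} (hG : Continuous G) (hmono : Monotone G) {l x : ℝ}
    (hl : G l < q) (hx : q ≤ G x) : G (quantile q G) = q := by
  have hb : BddBelow {x | q ≤ G x} :=
    ⟨l, fun z hz => not_lt.mp fun h => ((hmono h.le).trans_lt hl).not_ge hz⟩
  have hmem : q ≤ G (quantile q G) :=
    (isClosed_le continuous_const hG).csInf_mem ⟨x, hx⟩ hb
  refine le_antisymm (not_lt.mp fun hlt => ?_) hmem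
  obtain ⟨z, -, hz⟩ := intermediate_value_Icc' (f := fun t => -G t)
    (not_lt.mp fun h => (((hmono h.le).trans_lt hl).trans_le hmem).false : l ≤ quantile q G)
    hG.neg.continuousOn (show -q ∈ Set.Icc _ _ from ⟨by linarith, by linarith⟩)
  have hz : G z = q := by simpa using hz
  have h1 : quantile q G ≤ z := csInf_le hb hz.ge
  linarith [hmono h1]

set_option maxHeartbeats 1000000 in
/-- The derivative at `0` of the quantile of `G + ζ (δ_y - F)` with respect to `ζ`. -/
theorem hasDerivAt_quantile_perturbed {q : ℝ} {G g F : ℝ → ℝ} {θ c₁ c₂ c₃ y : ℝ} (hc₁ : 0 ≤ c₁)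
    (hc₂ : 0 < c₂) (hc₃ : 0 < c₃) (hG : ∀ x, HasDerivAt G (g x) x)
    (hg : ∀ x y, |g x - g y| ≤ c₃ * |x - y|) (hmono : Monotone G) (hθ : G θ = q)
    (hgθ : c₂ ≤ g θ) (hF0 : ∀ x, 0 ≤ F x) (hF1 : ∀ x, F x ≤ 1)
    (hF : ∀ x y, |F x - F y| ≤ c₁ * |x - y|) (hy : y ≠ θ) (hquant : quantile q G = θ) :
    HasDerivAt (fun ζ : ℝ => quantile q
      (fun x => ((if y ≤ x then (1 : ℝ) else 0) - F x) * ζ + G x))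
      ((F θ - if y ≤ θ then (1 : ℝ) else 0) / g θ) 0 := by
  have hgθ0 : 0 < g θ := hc₂.trans_le hgθ
  set J : ℝ := if y ≤ θ then (1 : ℝ) else 0 with hJ
  set D : ℝ := (F θ - J) / g θ with hD
  have hgD : g θ * D = F θ - J := by rw [hD]; field_simp
  set E : ℝ := |D| + 1 with hE
  have hE1 : 1 ≤ E := by simp [hE]
  -- `c₃ E² + c₁ E` bounds the second-order error at distance `E |ζ|` from `θ`; the extra `1` makes
  -- a shift by `± K ζ²` cross level `q`.
  set K : ℝ := (c₃ * E ^ 2 + c₁ * E + 1) / c₂ with hK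
  have hK0 : 0 < K := by positivity
  have hcK : c₂ * K = c₃ * E ^ 2 + c₁ * E + 1 := by rw [hK]; field_simp
  have hyθ : 0 < |y - θ| := abs_pos.mpr (sub_ne_zero.mpr hy)
  -- Within `ρ` of `θ` the slope of `G` is at least `c₂ / 2` and the indicator does not jump.
  set ρ : ℝ := min (c₂ / (2 * c₃)) (|y - θ| / 2) with hρ
  have hρ0 : 0 < ρ := by positivity
  have hρc : c₃ * ρ ≤ c₂ / 2 := by
    calc c₃ * ρ ≤ c₃ * (c₂ / (2 * c₃)) := mul_le_mul_of_nonneg_left (min_le_left _ _) hc₃.le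
      _ = c₂ / 2 := by field_simp
  have hρy : ρ < |y - θ| := (min_le_right _ _).trans_lt (half_lt_self hyθ)
  have hJx : ∀ x, |x - θ| ≤ ρ → (if y ≤ x then (1 : ℝ) else 0) = J := by
    intro x hx
    rw [hJ]
    have hx := abs_le.mp hx
    refine if_congr ?_ rfl rfl
    rcases lt_or_gt_of_ne hy with h | h
    · rw [abs_of_neg (by linarith)] at hρy
      exact ⟨fun _ => h.le, fun _ => by linarith⟩
    · rw [abs_of_pos (by linarith)] at hρy
      exact ⟨fun _ => by linarith, fun _ => by linarith⟩
  -- In order: `K ζ² ≤ |ζ|`; the bracketing points stay within `ρ`; the slope of `ζ F` is at most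
  -- `c₂ / 2`; the perturbation is smaller than the drop of `G` over a distance `ρ`.
  set z₀ : ℝ := min (1 / K) (min (ρ / E) (min (c₂ / (2 * (c₁ + 1))) (c₂ / 4 * ρ))) with hz₀
  have hz₀pos : 0 < z₀ := by positivity
  have key : ∀ ζ : ℝ, |ζ| < z₀ → |quantile q (fun x => ((if y ≤ x then (1 : ℝ) else 0) - F x) * ζ
      + G x) - θ - D * ζ| ≤ K * ζ ^ 2 := by
    intro ζ hζ
    rcases eq_or_ne ζ 0 with rfl | hζ0
    · simp [hquant]
    have hζp : 0 < |ζ| := abs_pos.mpr hζ0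
    have hKζ : K * |ζ| ≤ 1 := by
      have : |ζ| ≤ 1 / K := hζ.le.trans (min_le_left _ _)
      rwa [le_div_iff₀ hK0, mul_comm] at this
    have hEζ : E * |ζ| ≤ ρ := by
      have : |ζ| ≤ ρ / E := hζ.le.trans ((min_le_right _ _).trans (min_le_left _ _))
      rwa [le_div_iff₀ (by positivity), mul_comm] at this
    have hcζ : |ζ| * c₁ ≤ c₂ / 2 := by
      have : |ζ| ≤ c₂ / (2 * (c₁ + 1)) :=
        hζ.le.trans ((min_le_right _ _).trans ((min_le_right _ _).trans (min_le_left _ _)))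
      rw [le_div_iff₀ (by positivity)] at this
      nlinarith
    have hρζ : |ζ| < c₂ / 2 * ρ := by
      have : |ζ| ≤ c₂ / 4 * ρ :=
        hζ.le.trans ((min_le_right _ _).trans ((min_le_right _ _).trans (min_le_right _ _)))
      have : 0 < c₂ * ρ := by positivity
      linarith
    set H : ℝ → ℝ := fun x => ((if y ≤ x then (1 : ℝ) else 0) - F x) * ζ + G x with hH
    have hclose : ∀ s : ℝ, |s| ≤ K * ζ ^ 2 → |θ + D * ζ + s - θ| ≤ E * |ζ| := by
      intro s hs
      have e : θ + D * ζ + s - θ = D * ζ + s := by ring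
      rw [e]
      refine (abs_add_le _ _).trans ?_
      rw [abs_mul, hE, add_mul, one_mul]
      have : K * ζ ^ 2 ≤ |ζ| := by
        rw [← sq_abs]; nlinarith
      linarith
    have hval : ∀ s : ℝ, |s| ≤ K * ζ ^ 2 →
        |H (θ + D * ζ + s) - q - g θ * s| ≤ (c₃ * E ^ 2 + c₁ * E) * ζ ^ 2 := by
      intro s hs
      have hx := hclose s hs
      set x := θ + D * ζ + s with hxdef
      have h1 := abs_taylor_le hc₃.le hG hg θ x
      have h2 := hF x θ
      have e : H x - q - g θ * s = (G x - G θ - g θ * (x - θ)) - (F x - F θ) * ζ := by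
        simp only [hH, hJx x (hx.trans hEζ)]
        have : g θ * (x - θ) = (g θ * D) * ζ + g θ * s := by rw [hxdef]; ring
        rw [this, hgD, hθ]; ring
      rw [e]
      refine (abs_sub _ _).trans ?_
      rw [abs_mul]
      have h3 : (x - θ) ^ 2 ≤ E ^ 2 * ζ ^ 2 := by
        rw [← sq_abs, ← sq_abs ζ, ← mul_pow]
        exact pow_le_pow_left₀ (abs_nonneg _) hx 2
      have h4 : |F x - F θ| * |ζ| ≤ c₁ * E * ζ ^ 2 := by
        calc |F x - F θ| * |ζ| ≤ (c₁ * (E * |ζ|)) * |ζ| :=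
              mul_le_mul_of_nonneg_right (h2.trans (mul_le_mul_of_nonneg_left hx hc₁)) hζp.le
          _ = c₁ * E * ζ ^ 2 := by rw [← sq_abs ζ]; ring
      nlinarith [mul_le_mul_of_nonneg_left h3 hc₃.le]
    have hζ2 : 0 < ζ ^ 2 := by positivity
    have hKK : 0 ≤ K * ζ ^ 2 := by positivity
    have hgain : (c₃ * E ^ 2 + c₁ * E) * ζ ^ 2 < g θ * (K * ζ ^ 2) := by
      have : c₂ * K * ζ ^ 2 ≤ g θ * K * ζ ^ 2 := by gcongr
      rw [hcK] at this
      nlinarith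
    have hup : q ≤ H (θ + D * ζ + K * ζ ^ 2) := by
      have := (abs_le.mp (hval (K * ζ ^ 2) (abs_of_nonneg hKK).le)).1
      linarith
    have hlowAt : H (θ + D * ζ + -(K * ζ ^ 2)) < q := by
      have := (abs_le.mp (hval (-(K * ζ ^ 2)) (by rw [abs_neg, abs_of_nonneg hKK]))).2
      linarith
    have hxm := (hclose (-(K * ζ ^ 2)) (by rw [abs_neg, abs_of_nonneg hKK])).trans hEζ
    -- `H` need not be monotone. Near `θ` the slope of `G` dominates that of `ζ F`; further left,
    -- `G` lies below `q` by more than the whole perturbation.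
    have hlow : ∀ x < θ + D * ζ + -(K * ζ ^ 2), H x < q := by
      intro x hx
      set xm := θ + D * ζ + -(K * ζ ^ 2) with hxmdef
      have hxm' := abs_le.mp hxm
      rcases le_or_gt (θ - ρ) x with hxρ | hxρ
      · have hxa : |x - θ| ≤ ρ := by rw [abs_le]; constructor <;> linarith
        have s1 := half_slope_le hc₃.le hG hg hgθ hρc hxρ hx.le (by linarith)
        have s2 : (F xm - F x) * ζ ≤ c₁ * (xm - x) * |ζ| := by
          have := hF xm x
          rw [abs_of_pos (by linarith : 0 < xm - x)] at this
          refine (le_abs_self _).trans ?_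
          rw [abs_mul]
          exact mul_le_mul_of_nonneg_right this hζp.le
        have e : H xm - H x = G xm - G x - (F xm - F x) * ζ := by
          simp only [hH, hJx x hxa, hJx xm hxm]; ring
        have s3 := mul_le_mul_of_nonneg_right hcζ (by linarith : 0 ≤ xm - x)
        have s4 : c₁ * (xm - x) * |ζ| = |ζ| * c₁ * (xm - x) := by ring
        linarith
      · have s1 := half_slope_le hc₃.le hG hg hgθ hρc le_rfl (by linarith : θ - ρ ≤ θ) (by linarith)
        have s2 := hmono hxρ.le
        have s3 : ((if y ≤ x then (1 : ℝ) else 0) - F x) * ζ ≤ |ζ| := by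
          refine (le_abs_self _).trans ?_
          rw [abs_mul]
          refine mul_le_of_le_one_left hζp.le ?_
          have := hF0 x
          have := hF1 x
          rw [abs_le]
          split_ifs <;> constructor <;> linarith
        simp only [hH]
        linarith
    have u1 := quantile_le_of_le hlow hup
    have u2 := le_quantile hlow hup
    rw [abs_le]
    constructor <;> linarith
  rw [hasDerivAt_iff_isLittleO_nhds_zero]
  have hO : (fun ζ : ℝ => quantile q (fun x => ((if y ≤ x then (1 : ℝ) else 0) - F x) * (0 + ζ) + G x)
      - quantile q (fun x => ((if y ≤ x then (1 : ℝ) else 0) - F x) * 0 + G x) - ζ • D) =O[𝓝 0]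
      fun ζ => ζ ^ 2 := by
    refine Asymptotics.IsBigO.of_bound K ?_
    filter_upwards [Metric.ball_mem_nhds (0 : ℝ) hz₀pos] with ζ hζ
    have := key ζ (by simpa using hζ)
    simp only [zero_add, mul_zero, hquant, smul_eq_mul, Real.norm_eq_abs, abs_pow, sq_abs]
    rwa [mul_comm ζ D]
  refine hO.trans_isLittleO ?_
  simpa using Asymptotics.isLittleO_pow_pow (𝕜 := ℝ) (one_lt_two)

/-! ### Distribution functions of the segments -/

section Segments

variable {Ω : Type*} [MeasurableSpace Ω] {P : Measure Ω} {m : ℕ} {q : ℝ}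
  {Y : Fin (m + 1) → ℤ → Ω → ℝ} {f : Fin (m + 1) → ℝ → ℝ} {c₁ c₂ c₃ : ℝ}

theorem DensityCondition.abs_sub_le (h : DensityCondition P q Y f c₁ c₂ c₃) (i : Fin (m + 1))
    (x y : ℝ) : |f i x - f i y| ≤ c₃ * |x - y| :=
  convex_univ.norm_image_sub_le_of_norm_deriv_le (fun z _ => h.differentiable i z)
    (fun z _ => h.deriv_le i z) (Set.mem_univ y) (Set.mem_univ x)

theorem segCDF_monotone (i : Fin (m + 1)) : Monotone (segCDF P Y i) := monotone_cdf _

theorem exists_segCDF_lt (i : Fin (m + 1)) (hq : q ∈ Set.Ioo (0 : ℝ) 1) :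
    ∃ x, segCDF P Y i x < q :=
  ((tendsto_cdf_atBot (P.map (Y i 0))).eventually_lt_const hq.1).exists

theorem exists_le_segCDF (i : Fin (m + 1)) (hq : q ∈ Set.Ioo (0 : ℝ) 1) :
    ∃ x, q ≤ segCDF P Y i x :=
  (((tendsto_cdf_atTop (P.map (Y i 0))).eventually_const_lt hq.2).exists).imp fun _ h => h.le

variable [IsProbabilityMeasure P]

theorem segCDF_eq (hY : ∀ i t, Measurable (Y i t)) (i : Fin (m + 1)) (x : ℝ) :
    segCDF P Y i x = P.real (Y i 0 ⁻¹' Set.Iic x) := by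
  have := Measure.isProbabilityMeasure_map (μ := P) (hY i 0).aemeasurable
  rw [segCDF, cdf_eq_real, map_measureReal_apply (hY i 0) measurableSet_Iic]

/-- The density is continuous, so the fundamental theorem of calculus gives the derivative at every
point, not only almost everywhere. -/
theorem DensityCondition.hasDerivAt_segCDF (h : DensityCondition P q Y f c₁ c₂ c₃)
    (hY : ∀ i t, Measurable (Y i t)) (i : Fin (m + 1)) (x : ℝ) :
    HasDerivAt (segCDF P Y i) (f i x) x := by
  have hpr := Measure.isProbabilityMeasure_map (μ := P) (hY i 0).aemeasurable
  have hcont : Continuous (f i) := (h.differentiable i).continuous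
  have hint : Integrable (f i) := by
    refine ⟨hcont.aestronglyMeasurable, ?_⟩
    rw [hasFiniteIntegral_iff_ofReal (Eventually.of_forall (h.nonneg i))]
    have : (P.map (Y i 0)) Set.univ = 1 := measure_univ
    rw [h.density i, withDensity_apply _ MeasurableSet.univ, Measure.restrict_univ] at this
    rw [this]; exact ENNReal.one_lt_top
  have hF : ∀ z, segCDF P Y i z = ∫ t in Set.Iic z, f i t := by
    intro z
    rw [segCDF, cdf_eq_real, measureReal_def, h.density i, withDensity_apply _ measurableSet_Iic,
      integral_eq_lintegral_of_nonneg_ae (Eventually.of_forall (h.nonneg i))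
        hcont.aestronglyMeasurable]
  have hF2 : segCDF P Y i = fun z => (∫ t in Set.Iic 0, f i t) + ∫ t in (0 : ℝ)..z, f i t := by
    funext z
    rw [hF, ← intervalIntegral.integral_Iic_sub_Iic hint.integrableOn hint.integrableOn]
    ring
  rw [hF2]
  exact (intervalIntegral.integral_hasDerivAt_right (hcont.intervalIntegrable _ _)
    (hcont.stronglyMeasurableAtFilter _ _) hcont.continuousAt).const_add _

theorem DensityCondition.abs_segCDF_sub_le (h : DensityCondition P q Y f c₁ c₂ c₃)
    (hY : ∀ i t, Measurable (Y i t)) (i : Fin (m + 1)) (x y : ℝ) :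
    |segCDF P Y i x - segCDF P Y i y| ≤ c₁ * |x - y| :=
  convex_univ.norm_image_sub_le_of_norm_hasDerivWithin_le
    (fun z _ => (h.hasDerivAt_segCDF hY i z).hasDerivWithinAt)
    (fun z _ => by rw [Real.norm_eq_abs, abs_of_nonneg (h.nonneg i z)]; exact h.le_upper i z)
    (Set.mem_univ y) (Set.mem_univ x)

/-- A vector of mixture weights. -/
structure IsWeight (w : Fin (m + 1) → ℝ) : Prop where
  nonneg : ∀ i, 0 ≤ w i
  sum_eq_one : ∑ i, w i = 1

theorem IsWeight.abs_mixture_sub_le {w : Fin (m + 1) → ℝ} (hw : IsWeight w)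
    {G : Fin (m + 1) → ℝ → ℝ} {x y B : ℝ} (hB : ∀ i, |G i x - G i y| ≤ B) :
    |mixture w G x - mixture w G y| ≤ B := by
  rw [mixture, mixture, ← Finset.sum_sub_distrib]
  calc _ ≤ ∑ i, |w i * G i x - w i * G i y| := Finset.abs_sum_le_sum_abs _ _
    _ ≤ ∑ i, w i * B := Finset.sum_le_sum fun i _ => by
        rw [← mul_sub, abs_mul, abs_of_nonneg (hw.nonneg i)]
        exact mul_le_mul_of_nonneg_left (hB i) (hw.nonneg i)
    _ = B := by rw [← Finset.sum_mul, hw.sum_eq_one, one_mul]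

theorem IsWeight.le_mixture {w : Fin (m + 1) → ℝ} (hw : IsWeight w) {G : Fin (m + 1) → ℝ → ℝ}
    {x B : ℝ} (hB : ∀ i, B ≤ G i x) : B ≤ mixture w G x := by
  calc B = ∑ i, w i * B := by rw [← Finset.sum_mul, hw.sum_eq_one, one_mul]
    _ ≤ _ := Finset.sum_le_sum fun i _ => mul_le_mul_of_nonneg_left (hB i) (hw.nonneg i)

theorem IsWeight.mixture_le {w : Fin (m + 1) → ℝ} (hw : IsWeight w) {G : Fin (m + 1) → ℝ → ℝ}
    {x B : ℝ} (hB : ∀ i, G i x ≤ B) : mixture w G x ≤ B := by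
  calc _ ≤ ∑ i, w i * B :=
        Finset.sum_le_sum fun i _ => mul_le_mul_of_nonneg_left (hB i) (hw.nonneg i)
    _ = B := by rw [← Finset.sum_mul, hw.sum_eq_one, one_mul]

/-- Some weights may vanish; strictness comes from the maximum over the finite index set. -/
theorem IsWeight.mixture_lt {w : Fin (m + 1) → ℝ} (hw : IsWeight w) {G : Fin (m + 1) → ℝ → ℝ}
    {x B : ℝ} (hB : ∀ i, G i x < B) : mixture w G x < B := by
  refine (hw.mixture_le (B := Finset.univ.sup' Finset.univ_nonempty fun i => G i x) fun i =>
    Finset.le_sup' (fun i => G i x) (Finset.mem_univ i)).trans_lt ?_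
  simpa using hB

theorem IsWeight.monotone_mixture {w : Fin (m + 1) → ℝ} (hw : IsWeight w)
    {G : Fin (m + 1) → ℝ → ℝ} (hG : ∀ i, Monotone (G i)) : Monotone (mixture w G) :=
  fun _ _ hxy => Finset.sum_le_sum fun i _ => mul_le_mul_of_nonneg_left (hG i hxy) (hw.nonneg i)

theorem hasDerivAt_mixture {w : Fin (m + 1) → ℝ} {G g : Fin (m + 1) → ℝ → ℝ} {x : ℝ}
    (hG : ∀ i, HasDerivAt (G i) (g i x) x) : HasDerivAt (mixture w G) (mixture w g x) x :=
  HasDerivAt.fun_sum fun i _ => (hG i).const_mul (w i)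

theorem DensityCondition.segCDF_quantile (h : DensityCondition P q Y f c₁ c₂ c₃)
    (hY : ∀ i t, Measurable (Y i t)) (hq : q ∈ Set.Ioo (0 : ℝ) 1) (i : Fin (m + 1)) :
    segCDF P Y i (quantile q (segCDF P Y i)) = q := by
  obtain ⟨l, hl⟩ := exists_segCDF_lt (P := P) (Y := Y) i hq
  obtain ⟨u, hu⟩ := exists_le_segCDF (P := P) (Y := Y) i hq
  exact apply_quantile_eq (continuous_iff_continuousAt.mpr fun x =>
    (h.hasDerivAt_segCDF hY i x).continuousAt) (segCDF_monotone i) hl hu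

/-- Left of all segment quantiles every component is below `q`, and at the largest one every
component is at least `q`. The mixture quantile thus falls in the interval where the lower density
bound is assumed. -/
theorem DensityCondition.quantile_mixture (h : DensityCondition P q Y f c₁ c₂ c₃)
    (hY : ∀ i t, Measurable (Y i t)) (hq : q ∈ Set.Ioo (0 : ℝ) 1) {w : Fin (m + 1) → ℝ}
    (hw : IsWeight w) :
    mixture w (segCDF P Y) (quantile q (mixture w (segCDF P Y))) = q ∧
      c₂ ≤ mixture w f (quantile q (mixture w (segCDF P Y))) := by
  set θ := fun j => quantile q (segCDF P Y j) with hθ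
  have hlow : ∀ x < ⨅ j, θ j, mixture w (segCDF P Y) x < q := fun x hx => by
    refine hw.mixture_lt fun i => not_le.mp fun hi => ?_
    obtain ⟨l, hl⟩ := exists_segCDF_lt (P := P) (Y := Y) i hq
    have h1 : θ i ≤ x := quantile_le_of_le
      (fun z hz => (segCDF_monotone i hz.le).trans_lt hl) hi
    exact absurd ((ciInf_le (Finite.bddBelow_range θ) i).trans h1) (not_le.mpr hx)
  have hup : q ≤ mixture w (segCDF P Y) (⨆ j, θ j) := hw.le_mixture fun i => by
    rw [← h.segCDF_quantile hY hq i]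
    exact segCDF_monotone i (le_ciSup (Finite.bddAbove_range θ) i)
  refine ⟨apply_quantile_eq (continuous_iff_continuousAt.mpr fun x =>
    (hasDerivAt_mixture fun i => h.hasDerivAt_segCDF hY i x).continuousAt)
    (hw.monotone_mixture segCDF_monotone) (hlow _ (sub_one_lt _)) hup, ?_⟩
  exact hw.le_mixture fun i => h.lower_le i _
    ⟨le_quantile hlow hup, quantile_le_of_le hlow hup⟩

/-- The partial influence function is a Gâteaux derivative of the quantile functional. -/
theorem DensityCondition.isGateauxDeriv (h : DensityCondition P q Y f c₁ c₂ c₃)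
    (hc₁ : 0 < c₁) (hc₂ : 0 < c₂) (hc₃ : 0 < c₃) (hY : ∀ i t, Measurable (Y i t))
    (hq : q ∈ Set.Ioo (0 : ℝ) 1) {w : Fin (m + 1) → ℝ} (hw : IsWeight w) (i : Fin (m + 1)) {y : ℝ}
    (hy : y ≠ quantile q (mixture w (segCDF P Y))) :
    IsGateauxDeriv q (segCDF P Y) w i y (partialInfluence q (segCDF P Y) f w i y) :=
  hasDerivAt_quantile_perturbed hc₁.le hc₂ hc₃
    (fun _ => hasDerivAt_mixture fun i => h.hasDerivAt_segCDF hY i _)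
    (fun x y => hw.abs_mixture_sub_le fun i => h.abs_sub_le i x y)
    (hw.monotone_mixture segCDF_monotone) (h.quantile_mixture hY hq hw).1
    (h.quantile_mixture hY hq hw).2 (fun x => cdf_nonneg _ x) (fun x => cdf_le_one _ x)
    (h.abs_segCDF_sub_le hY i) hy rfl

end Segments

/-! ### Segments and windows -/

theorem exists_segment {m : ℕ} (k : Fin (m + 2) → ℕ) {t : ℕ} (h0 : k 0 < t)
    (hl : t ≤ k (Fin.last (m + 1))) : ∃ i : Fin (m + 1), k i.castSucc < t ∧ t ≤ k i.succ := by
  induction m with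
  | zero => exact ⟨0, h0, hl⟩
  | succ m ih =>
    rcases Nat.lt_or_ge (k (Fin.last (m + 1)).castSucc) t with h | h
    · exact ⟨Fin.last (m + 1), h, hl⟩
    · obtain ⟨i, hi⟩ := ih (fun j => k j.castSucc) h0 h
      exact ⟨i.castSucc, hi.1, hi.2⟩

theorem sum_Ioc_segments {m : ℕ} (k : Fin (m + 2) → ℕ) (hk : Monotone k) (g : ℕ → ℝ) :
    ∑ i : Fin (m + 1), ∑ t ∈ Finset.Ioc (k i.castSucc) (k i.succ), g t =
      ∑ t ∈ Finset.Ioc (k 0) (k (Fin.last (m + 1))), g t := by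
  induction m with
  | zero => simp
  | succ m ih =>
    rw [Fin.sum_univ_castSucc]
    have := ih (fun j => k j.castSucc) (fun _ _ h => hk (Fin.castSucc_le_castSucc_iff.mpr h))
    simp only [Fin.castSucc_zero] at this
    simp only [Fin.succ_castSucc]
    rw [this, Fin.succ_last]
    exact Finset.sum_Ioc_consecutive g (hk (Fin.zero_le _)) (hk (Fin.le_last _))

section Model

variable {Ω : Type*} [MeasurableSpace Ω] {P : Measure Ω} {m n : ℕ} {k : Fin (m + 2) → ℕ}
  {Y : Fin (m + 1) → ℤ → Ω → ℝ} {X : ℕ → Ω → ℝ} {a b : ℕ}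

theorem IsPiecewiseStationary.sum_segWindow (hM : IsPiecewiseStationary P n k Y X) (ha : 1 ≤ a)
    (hb : b ≤ n) (g : ℕ → ℝ) :
    ∑ i, ∑ t ∈ segWindow k a b i, g t = ∑ t ∈ Finset.Icc a b, g t := by
  have h := sum_Ioc_segments k hM.k_strictMono.monotone
    (fun t => if t ∈ Finset.Icc a b then g t else 0)
  rw [hM.k_first, hM.k_last, ← Finset.sum_filter] at h
  have e : (Finset.Ioc 0 n).filter (fun t => t ∈ Finset.Icc a b) = Finset.Icc a b := by
    ext t
    simp only [Finset.mem_filter, Finset.mem_Ioc, Finset.mem_Icc]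
    omega
  rw [e] at h
  rw [← h]
  refine Finset.sum_congr rfl fun i _ => ?_
  rw [← Finset.sum_filter, segWindow, Finset.inter_comm, Finset.filter_mem_eq_inter]

theorem window_length_pos (hab : a < b) : (1 : ℝ) ≤ (b : ℝ) - a + 1 := by
  have : (a : ℝ) < b := by exact_mod_cast hab
  linarith

theorem card_segWindow_eq (hab : a < b) (i : Fin (m + 1)) :
    ((segWindow k a b i).card : ℝ) = ((b : ℝ) - a + 1) * weight k a b i := by
  have := window_length_pos hab
  rw [weight]
  field_simp

theorem card_window (hab : a < b) : ((Finset.Icc a b).card : ℝ) = (b : ℝ) - a + 1 := by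
  rw [Nat.card_Icc, Nat.cast_sub (by omega)]
  push_cast
  ring

theorem IsPiecewiseStationary.isWeight (hM : IsPiecewiseStationary P n k Y X) (ha : 1 ≤ a)
    (hab : a < b) (hb : b ≤ n) : IsWeight (weight k a b) := by
  have hN := window_length_pos hab
  refine ⟨fun i => div_nonneg (Nat.cast_nonneg _) (by linarith), ?_⟩
  have := hM.sum_segWindow ha hb fun _ => 1
  simp only [Finset.sum_const, nsmul_eq_mul, mul_one] at this
  simp only [weight]
  rw [← Finset.sum_div, this, card_window hab]
  exact div_self (by linarith)

theorem sum_segWindow_const (hab : a < b) (F : Fin (m + 1) → ℝ → ℝ) (y : ℝ) :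
    ∑ i, ∑ _t ∈ segWindow k a b i, F i y =
      ((b : ℝ) - a + 1) * mixture (weight k a b) F y := by
  rw [mixture, Finset.mul_sum]
  refine Finset.sum_congr rfl fun i _ => ?_
  rw [Finset.sum_const, nsmul_eq_mul, card_segWindow_eq hab, mul_assoc]

theorem mul_empiricalCDF (hab : a < b) (x : ℕ → ℝ) (y : ℝ) :
    ((b : ℝ) - a + 1) * empiricalCDF x a b y =
      ∑ t ∈ Finset.Icc a b, if x t ≤ y then (1 : ℝ) else 0 := by
  have := window_length_pos hab
  rw [empiricalCDF]
  field_simp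

theorem monotone_empiricalCDF (hab : a < b) (x : ℕ → ℝ) : Monotone (empiricalCDF x a b) := by
  intro y z hyz
  have hN := window_length_pos hab
  refine div_le_div_of_nonneg_right (Finset.sum_le_sum fun t _ => ?_) (by linarith)
  split_ifs with h1 h2 <;> first | exact absurd (h1.trans hyz) h2 | norm_num

theorem empiricalCDF_nonneg (hab : a < b) (x : ℕ → ℝ) (y : ℝ) : 0 ≤ empiricalCDF x a b y := by
  have hN := window_length_pos hab
  refine div_nonneg (Finset.sum_nonneg fun t _ => ?_) (by linarith)
  split_ifs <;> norm_num

theorem empiricalCDF_eq_zero {x : ℕ → ℝ} {y : ℝ} (h : ∀ t ∈ Finset.Icc a b, y < x t) :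
    empiricalCDF x a b y = 0 := by
  rw [empiricalCDF, Finset.sum_eq_zero fun t ht => if_neg (not_le.mpr (h t ht)), zero_div]

theorem empiricalCDF_eq_one (hab : a < b) {x : ℕ → ℝ} {y : ℝ}
    (h : ∀ t ∈ Finset.Icc a b, x t ≤ y) : empiricalCDF x a b y = 1 := by
  have hN := window_length_pos hab
  rw [empiricalCDF, Finset.sum_congr rfl fun t ht => if_pos (h t ht), Finset.sum_const,
    nsmul_eq_mul, card_window hab, mul_one]
  exact div_self (by linarith)

theorem empiricalCDF_le_one (hab : a < b) (x : ℕ → ℝ) (y : ℝ) : empiricalCDF x a b y ≤ 1 := by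
  have hN := window_length_pos hab
  refine div_le_one_of_le₀ ?_ (by linarith)
  rw [← card_window hab]
  refine (Finset.sum_le_sum (g := fun _ => (1 : ℝ)) fun t _ => ?_).trans (by simp)
  split_ifs <;> norm_num

/-- The remainder in terms of the centred empirical distribution function. -/
theorem IsPiecewiseStationary.mul_remainder (hM : IsPiecewiseStationary P n k Y X) (ha : 1 ≤ a)
    (hab : a < b) (hb : b ≤ n) (q : ℝ) (F f : Fin (m + 1) → ℝ → ℝ) (x : ℕ → ℝ) :
    ((b : ℝ) - a + 1) * remainder q k F f x a b =
      ((b : ℝ) - a + 1) *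
        (quantile q (empiricalCDF x a b) - quantile q (mixture (weight k a b) F)) +
      ((b : ℝ) - a + 1) * (empiricalCDF x a b (quantile q (mixture (weight k a b) F)) -
        mixture (weight k a b) F (quantile q (mixture (weight k a b) F))) /
        mixture (weight k a b) f (quantile q (mixture (weight k a b) F)) := by
  have hN := window_length_pos hab
  have hN0 : (b : ℝ) - a + 1 ≠ 0 := by linarith
  set θ := quantile q (mixture (weight k a b) F) with hθ
  -- Over the window the terms `F i θ` add up to `N` times the mixture and the indicators to `N`
  -- times the empirical CDF.
  have e : ((b : ℝ) - a + 1) * influenceMean q k F f x a b =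
      -(((b : ℝ) - a + 1) * (empiricalCDF x a b θ - mixture (weight k a b) F θ)) /
        mixture (weight k a b) f θ := by
    rw [influenceMean, mul_div_cancel₀ _ hN0, mul_sub, mul_empiricalCDF hab, neg_sub,
      ← sum_segWindow_const hab, ← hM.sum_segWindow ha hb, ← Finset.sum_sub_distrib, Finset.sum_div]
    refine Finset.sum_congr rfl fun i _ => ?_
    rw [← Finset.sum_sub_distrib, Finset.sum_div]
    rfl
  rw [remainder, ← hθ, mul_sub, e]
  ring

/-- Bound for the remainder by the window length and the size of the observations. -/
theorem IsPiecewiseStationary.abs_mul_remainder_le (hM : IsPiecewiseStationary P n k Y X)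
    (ha : 1 ≤ a) (hab : a < b) (hb : b ≤ n) {q : ℝ} (hq : q ∈ Set.Ioo (0 : ℝ) 1)
    {F f : Fin (m + 1) → ℝ → ℝ} {x : ℕ → ℝ} {R x₀ c₂ : ℝ} (hc₂ : 0 < c₂)
    (hR : ∀ t ∈ Finset.Icc a b, |x t| ≤ R)
    (hθ : |quantile q (mixture (weight k a b) F)| ≤ x₀)
    (hG : mixture (weight k a b) F (quantile q (mixture (weight k a b) F)) = q)
    (hg : c₂ ≤ mixture (weight k a b) f (quantile q (mixture (weight k a b) F))) :
    |((b : ℝ) - a + 1) * remainder q k F f x a b| ≤ ((b : ℝ) - a + 1) * (R + x₀ + 1 / c₂) := by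
  have hN := window_length_pos hab
  rw [hM.mul_remainder ha hab hb]
  set θ := quantile q (mixture (weight k a b) F) with hθdef
  have hlow : ∀ z < -R, empiricalCDF x a b z < q := fun z hz => by
    rw [empiricalCDF_eq_zero fun t ht => hz.trans_le (abs_le.mp (hR t ht)).1]
    exact hq.1
  have hup : q ≤ empiricalCDF x a b R := by
    rw [empiricalCDF_eq_one hab fun t ht => (abs_le.mp (hR t ht)).2]
    exact hq.2.le
  have h1 : |quantile q (empiricalCDF x a b)| ≤ R :=
    abs_le.mpr ⟨le_quantile hlow hup, quantile_le_of_le hlow hup⟩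
  have h2 : |empiricalCDF x a b θ - mixture (weight k a b) F θ| ≤ 1 := by
    have := empiricalCDF_nonneg hab x θ
    have := empiricalCDF_le_one hab x θ
    have := hq.1
    have := hq.2
    rw [hG, abs_le]
    constructor <;> linarith
  rw [mul_div_assoc, ← mul_add, abs_mul, abs_of_pos (by linarith : 0 < (b : ℝ) - a + 1)]
  refine mul_le_mul_of_nonneg_left ((abs_add_le _ _).trans (add_le_add ?_ ?_)) (by linarith)
  · exact (abs_sub _ _).trans (add_le_add h1 hθ)
  · rw [abs_div]
    exact div_le_div₀ zero_le_one h2 hc₂ (hg.trans (le_abs_self _))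

end Model

/-! ### Deterministic Bahadur expansion. -/

/-- Deterministic Bahadur expansion: the quantile of a monotone function `H` close to a smooth
function `G` on a grid around the quantile `θ` of `G`. -/
theorem abs_bahadur_le {q : ℝ} {G g H : ℝ → ℝ} {θ c₂ c₃ δ N s₁ s₂ : ℝ} {K : ℕ} (hK : 1 ≤ K)
    (hc₂ : 0 < c₂) (hc₃ : 0 ≤ c₃) (hδ : 0 < δ) (hN : 0 < N) (hG : ∀ x, HasDerivAt G (g x) x)
    (hg : ∀ x y, |g x - g y| ≤ c₃ * |x - y|) (hθ : G θ = q) (hgθ : c₂ ≤ g θ)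
    (hδc : c₃ * δ ≤ c₂ / 2) (hH : Monotone H) (h₁ : |N * (H θ - G θ)| ≤ s₁)
    (h₂ : ∀ j ≤ 2 * K, |N * (H (θ - δ + j * (δ / K)) - G (θ - δ + j * (δ / K))) -
      N * (H θ - G θ)| ≤ s₂) (hs : s₁ + s₂ < N * (c₂ / 2 * δ)) :
    |N * (quantile q H - θ) + N * (H θ - G θ) / g θ| ≤
      (s₂ + c₃ * (N * δ ^ 2)) / c₂ + N * δ / K := by
  have hK0 : (0 : ℝ) < K := by exact_mod_cast hK
  have hgθ0 : 0 < g θ := hc₂.trans_le hgθ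
  set x : ℕ → ℝ := fun j => θ - δ + j * (δ / K) with hx
  have hS := abs_le.mp h₁
  have hx0 : x 0 = θ - δ := by simp [hx]
  have hx2 : x (2 * K) = θ + δ := by
    simp only [hx]; push_cast; field_simp; ring
  have hxr : ∀ j ≤ 2 * K, |x j - θ| ≤ δ := by
    intro j hj
    have h0 : 0 ≤ (j : ℝ) * (δ / K) := by positivity
    have h2 : (j : ℝ) * (δ / K) ≤ 2 * δ := by
      have : (j : ℝ) ≤ 2 * K := by exact_mod_cast hj
      calc (j : ℝ) * (δ / K) ≤ 2 * K * (δ / K) := by gcongr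
        _ = 2 * δ := by field_simp
    simp only [hx]
    rw [abs_le]; constructor <;> linarith
  have htay : ∀ j ≤ 2 * K, |N * G (x j) - N * q - N * g θ * (x j - θ)| ≤ c₃ * (N * δ ^ 2) := by
    intro j hj
    have h1 := abs_taylor_le hc₃ hG hg θ (x j)
    have h3 : (x j - θ) ^ 2 ≤ δ ^ 2 := by
      rw [← sq_abs]; exact pow_le_pow_left₀ (abs_nonneg _) (hxr j hj) 2
    have h4 := h1.trans (mul_le_mul_of_nonneg_left h3 hc₃)
    rw [hθ] at h4
    calc _ = N * |G (x j) - q - g θ * (x j - θ)| := by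
          rw [← abs_of_pos hN, ← abs_mul, abs_of_pos hN]; congr 1; ring
      _ ≤ N * (c₃ * δ ^ 2) := mul_le_mul_of_nonneg_left h4 hN.le
      _ = _ := by ring
  -- By `hs`, the rise `N (c₂ / 2) δ` of `N G` over half the grid outweighs the deviations, so `H`
  -- crosses `q` inside the grid.
  have hlast : q ≤ H (x (2 * K)) := by
    have a1 := half_slope_le hc₃ hG hg hgθ hδc (by linarith) (by linarith : θ ≤ θ + δ) le_rfl
    have a2 := (abs_le.mp (h₂ (2 * K) le_rfl)).1
    change -s₂ ≤ N * (H (x (2 * K)) - G (x (2 * K))) - _ at a2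
    rw [hx2] at a2 ⊢
    have a3 := mul_le_mul_of_nonneg_left a1 hN.le
    rw [hθ] at *
    have a4 : N * q ≤ N * H (θ + δ) := by
      have : c₂ / 2 * (θ + δ - θ) = c₂ / 2 * δ := by ring
      rw [this] at a3
      linarith
    exact le_of_mul_le_mul_left a4 hN
  have hfirst : H (x 0) < q := by
    have a1 := half_slope_le hc₃ hG hg hgθ hδc le_rfl (by linarith : θ - δ ≤ θ) (by linarith)
    have a2 := (abs_le.mp (h₂ 0 (Nat.zero_le _))).2
    change N * (H (x 0) - G (x 0)) - _ ≤ s₂ at a2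
    rw [hx0] at a2 ⊢
    have a3 := mul_le_mul_of_nonneg_left a1 hN.le
    rw [hθ] at *
    have a4 : N * H (θ - δ) < N * q := by
      have : c₂ / 2 * (θ - (θ - δ)) = c₂ / 2 * δ := by ring
      rw [this] at a3
      linarith
    exact lt_of_mul_lt_mul_left a4 hN.le
  classical
  have hex : ∃ j, q ≤ H (x j) := ⟨_, hlast⟩
  -- The first grid point with `H ≥ q` is not the left end, so it has a predecessor; the quantile
  -- lies between the two.
  obtain ⟨j, hj⟩ : ∃ j, Nat.find hex = j + 1 := Nat.exists_eq_succ_of_ne_zero fun h0 => by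
    have := Nat.find_spec hex
    rw [h0] at this
    exact absurd this (not_le.mpr hfirst)
  have hj1 : q ≤ H (x (j + 1)) := hj ▸ Nat.find_spec hex
  have hj0 : H (x j) < q := not_le.mp (Nat.find_min hex (by omega))
  have hjK : j + 1 ≤ 2 * K := hj ▸ Nat.find_min' hex hlast
  have hlow : ∀ z < x j, H z < q := fun z hz => (hH hz.le).trans_lt hj0
  have hup := quantile_le_of_le hlow hj1
  have hdn := le_quantile hlow hj1
  have hstep : x (j + 1) = x j + δ / K := by
    simp only [hx]; push_cast; ring
  set t := quantile q H with ht
  set S := N * (H θ - G θ) with hSdef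
  have b1 := (abs_le.mp (h₂ (j + 1) hjK)).2
  change N * (H (x (j + 1)) - G (x (j + 1))) - S ≤ s₂ at b1
  have b2 := (abs_le.mp (h₂ j (by omega))).1
  change -s₂ ≤ N * (H (x j) - G (x j)) - S at b2
  have b3 := (abs_le.mp (htay (j + 1) hjK)).2
  have b4 := (abs_le.mp (htay j (by omega))).1
  have b5 := mul_le_mul_of_nonneg_left hj1 hN.le
  have b6 := mul_le_mul_of_nonneg_left hj0.le hN.le
  have hNg : 0 < N * g θ := by positivity
  have b7 := mul_le_mul_of_nonneg_left (by linarith : x (j + 1) ≤ t + δ / K) hNg.le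
  have b8 := mul_le_mul_of_nonneg_left (by linarith : t - δ / K ≤ x j) hNg.le
  have hmain : |N * g θ * (t - θ) + S| ≤ s₂ + c₃ * (N * δ ^ 2) + N * g θ * (δ / K) := by
    rw [abs_le]
    constructor <;> linarith
  have e : N * (t - θ) + S / g θ = (N * g θ * (t - θ) + S) / g θ := by field_simp
  have hs₂ : 0 ≤ s₂ := (abs_nonneg _).trans (h₂ 0 (Nat.zero_le _))
  rw [e, abs_div, abs_of_pos hgθ0]
  calc _ ≤ (s₂ + c₃ * (N * δ ^ 2) + N * g θ * (δ / K)) / g θ :=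
        div_le_div_of_nonneg_right hmain hgθ0.le
    _ = (s₂ + c₃ * (N * δ ^ 2)) / g θ + N * δ / K := by field_simp
    _ ≤ _ := by gcongr

/-! ### Empirical process of piecewise stationary data and quantile location. -/

section Model

variable {Ω : Type*} [MeasurableSpace Ω] {P : Measure Ω} {m n : ℕ} {k : Fin (m + 2) → ℕ}
  {Y : Fin (m + 1) → ℤ → Ω → ℝ} {X : ℕ → Ω → ℝ} {f : Fin (m + 1) → ℝ → ℝ} {a b : ℕ}
  {q c₁ c₂ c₃ C lam : ℝ}

theorem IsPiecewiseStationary.exists_eq (hM : IsPiecewiseStationary P n k Y X) {t : ℕ}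
    (h1 : 1 ≤ t) (h2 : t ≤ n) :
    ∃ i, k i.castSucc < t ∧ t ≤ k i.succ ∧ X t = Y i (t : ℤ) := by
  obtain ⟨i, hi1, hi2⟩ := exists_segment k (t := t) (by rw [hM.k_first]; omega)
    (by rw [hM.k_last]; omega)
  exact ⟨i, hi1, hi2, hM.data_eq i t hi1 hi2⟩

theorem IsPiecewiseStationary.measurable_data (hM : IsPiecewiseStationary P n k Y X) (t : ℕ)
    (h1 : 1 ≤ t) (h2 : t ≤ n) : Measurable (X t) := by
  obtain ⟨i, -, -, hi⟩ := hM.exists_eq h1 h2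
  rw [hi]
  exact hM.measurable i t

theorem IsStationary.measureReal_preimage {Z : ℤ → Ω → ℝ} (hZ : IsStationary P Z)
    (hZm : ∀ t, Measurable (Z t)) (t : ℤ) {I : Set ℝ} (hI : MeasurableSet I) :
    P.real (Z t ⁻¹' I) = P.real (Z 0 ⁻¹' I) := by
  have h := congrArg (fun μ : Measure (ℤ → ℝ) => μ.real ((fun z : ℤ → ℝ => z 0) ⁻¹' I)) (hZ t)
  rw [map_measureReal_apply (measurable_pi_lambda _ fun s => hZm (s + t))
      ((measurable_pi_apply 0) hI),
    map_measureReal_apply (measurable_pi_lambda _ fun s => hZm s) ((measurable_pi_apply 0) hI)] at h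
  simpa [Set.preimage, zero_add] using h

theorem centeredCount_Iic_sub [IsFiniteMeasure P] (hX : ∀ t ∈ Finset.Icc a b, Measurable (X t))
    {θ x : ℝ} (h : θ ≤ x) (ω : Ω) :
    centeredCount P X a b (Set.Iic x) ω - centeredCount P X a b (Set.Iic θ) ω =
      centeredCount P X a b (Set.Ioc θ x) ω := by
  rw [centeredCount, centeredCount, centeredCount, ← Finset.sum_sub_distrib]
  refine Finset.sum_congr rfl fun t ht => ?_
  have hd : Disjoint (X t ⁻¹' Set.Iic θ) (X t ⁻¹' Set.Ioc θ x) :=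
    (Set.Iic_disjoint_Ioc le_rfl).preimage _
  have hu : X t ⁻¹' Set.Iic x = X t ⁻¹' Set.Iic θ ∪ X t ⁻¹' Set.Ioc θ x := by
    rw [← Set.preimage_union, Set.Iic_union_Ioc_eq_Iic h]
  rw [hu, measureReal_union hd (hX t ht measurableSet_Ioc), Set.indicator_union_of_disjoint hd]
  ring

/-- Increments of the centred empirical process are counts in an interval of small probability,
which is what makes them smaller than the process itself. -/
theorem abs_centeredCount_Iic_sub [IsFiniteMeasure P]
    (hX : ∀ t ∈ Finset.Icc a b, Measurable (X t)) (θ x : ℝ) (ω : Ω) :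
    |centeredCount P X a b (Set.Iic x) ω - centeredCount P X a b (Set.Iic θ) ω| =
      |centeredCount P X a b (Set.uIoc θ x) ω| := by
  rcases le_total θ x with h | h
  · rw [Set.uIoc_of_le h, centeredCount_Iic_sub hX h]
  · rw [Set.uIoc_of_ge h, abs_sub_comm, centeredCount_Iic_sub hX h]

/-- By stationarity every observation of segment `i` has CDF `segCDF P Y i`, so the concentration
bounds become bounds on the empirical CDF minus the mixture. -/
theorem IsPiecewiseStationary.centeredCount_Iic [IsProbabilityMeasure P]
    (hM : IsPiecewiseStationary P n k Y X) (ha : 1 ≤ a) (hab : a < b) (hb : b ≤ n) (y : ℝ) (ω : Ω) :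
    centeredCount P X a b (Set.Iic y) ω = ((b : ℝ) - a + 1) *
      (empiricalCDF (fun t => X t ω) a b y - mixture (weight k a b) (segCDF P Y) y) := by
  rw [mul_sub, mul_empiricalCDF hab, ← sum_segWindow_const hab, centeredCount,
    Finset.sum_sub_distrib]
  congr 1
  rw [← hM.sum_segWindow ha hb]
  refine Finset.sum_congr rfl fun i _ => Finset.sum_congr rfl fun t ht => ?_
  have ht := Finset.mem_Ioc.mp (Finset.mem_inter.mp ht).2
  rw [hM.data_eq i t ht.1 ht.2, (hM.stationary i).measureReal_preimage (hM.measurable i) _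
    measurableSet_Iic, segCDF_eq hM.measurable]

theorem IsPiecewiseStationary.measureReal_uIoc_le [IsProbabilityMeasure P]
    (hM : IsPiecewiseStationary P n k Y X) (hD : DensityCondition P q Y f c₁ c₂ c₃) (θ x : ℝ) (t : ℕ)
    (h1 : 1 ≤ t) (h2 : t ≤ n) : P.real (X t ⁻¹' Set.uIoc θ x) ≤ c₁ * |x - θ| := by
  obtain ⟨i, -, -, hi⟩ := hM.exists_eq h1 h2
  rw [hi, (hM.stationary i).measureReal_preimage (hM.measurable i) _ measurableSet_uIoc]
  have key : ∀ u v : ℝ, u ≤ v → P.real (Y i 0 ⁻¹' Set.Ioc u v) =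
      segCDF P Y i v - segCDF P Y i u := by
    intro u v huv
    have hd : Disjoint (Y i 0 ⁻¹' Set.Iic u) (Y i 0 ⁻¹' Set.Ioc u v) :=
      (Set.Iic_disjoint_Ioc le_rfl).preimage _
    rw [segCDF_eq hM.measurable, segCDF_eq hM.measurable, ← Set.Iic_union_Ioc_eq_Iic huv,
      Set.preimage_union, measureReal_union hd (hM.measurable i 0 measurableSet_Ioc)]
    ring
  rcases le_total θ x with h | h
  · rw [Set.uIoc_of_le h, key _ _ h]
    exact (le_abs_self _).trans (hD.abs_segCDF_sub_le hM.measurable i x θ)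
  · rw [Set.uIoc_of_ge h, key _ _ h, abs_sub_comm]
    exact (le_abs_self _).trans (hD.abs_segCDF_sub_le hM.measurable i θ x)

/-- Under the tail condition the quantiles of all mixtures lie in a fixed bounded interval. -/
theorem exists_abs_quantile_mixture_le (m : ℕ) (hq : q ∈ Set.Ioo (0 : ℝ) 1) (hlam : 0 < lam) :
    ∃ x₀ : ℝ, 0 < x₀ ∧ ∀ {Ω : Type*} [MeasurableSpace Ω] (P : Measure Ω) [IsProbabilityMeasure P]
      (Y : Fin (m + 1) → ℤ → Ω → ℝ), (∀ i t, Measurable (Y i t)) → TailCondition P Y C lam →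
      ∀ w : Fin (m + 1) → ℝ, IsWeight w → |quantile q (mixture w (segCDF P Y))| ≤ x₀ := by
  have hlim : Tendsto (fun x : ℝ => C * x ^ (-lam)) atTop (𝓝 0) := by
    simpa using (tendsto_rpow_neg_atTop hlam).const_mul C
  -- Beyond this `x` both tails have mass below `min q (1 - q)`, whatever the segment, series or
  -- probability space.
  obtain ⟨x, hx0, hx1, hx2⟩ := ((eventually_gt_atTop (0 : ℝ)).and
    ((hlim.eventually_lt_const hq.1).and (hlim.eventually_lt_const (sub_pos.mpr hq.2)))).exists
  refine ⟨2 * x, by positivity, ?_⟩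
  intro Ω _ P _ Y hY hT w hw
  have hlo : ∀ z < -(2 * x), mixture w (segCDF P Y) z < q := fun z hz => by
    refine hw.mixture_lt fun i => lt_of_le_of_lt ?_ hx1
    rw [segCDF_eq hY]
    refine le_trans (measureReal_mono (fun ω hω => ?_) (measure_ne_top _ _)) (hT i 0 x hx0)
    have hω : Y i 0 ω ≤ z := hω
    rw [Set.mem_ofPred_eq, lt_abs]
    right; linarith
  have hhi : q ≤ mixture w (segCDF P Y) (2 * x) := hw.le_mixture fun i => by
    rw [segCDF_eq hY]
    have h1 : P.real (Y i 0 ⁻¹' Set.Iic (2 * x))ᶜ ≤ C * x ^ (-lam) := by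
      refine le_trans (measureReal_mono (fun ω hω => ?_) (measure_ne_top _ _)) (hT i 0 x hx0)
      have hω : ¬ Y i 0 ω ≤ 2 * x := hω
      rw [Set.mem_ofPred_eq, lt_abs]
      left; linarith
    rw [probReal_compl_eq_one_sub (hY i 0 measurableSet_Iic)] at h1
    linarith
  exact abs_le.mpr ⟨le_quantile hlo hhi, quantile_le_of_le hlo hhi⟩

/-! ### Scales and the union bound over windows. -/

/-- Choice of scale: the numerical conditions, in terms of `u = n ^ (1 / 40)`, under which the
expansion is accurate up to `κ √n`. -/
structure ScaleCondition (c₁ c₂ c₃ x₀ κ u : ℝ) : Prop where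
  two_le : 2 ≤ u
  spread : c₃ * u⁻¹ ≤ c₂ / 2
  separation : (2 + √(1 + c₁)) * u < c₂ / 2 * u ^ 2
  long : (√(1 + c₁) * u ^ 12 + c₃ * u ^ 4) / c₂ + u ^ 19 ≤ κ * u ^ 20
  short : u ^ 6 * (u ^ 12 + x₀ + 1 / c₂) ≤ κ * u ^ 20

/-- Each inequality compares leading powers of `u`: `0` with `1` after inversion in `spread`, `1`
with `2` in `separation`, `19` with `20` in `long`, `18` with `20` in `short`. -/
theorem eventually_scaleCondition (hc₂ : 0 < c₂) (hc₃ : 0 < c₃) {x₀ κ : ℝ} (hx₀ : 0 < x₀)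
    (hκ : 0 < κ) : ∀ᶠ u in atTop, ScaleCondition c₁ c₂ c₃ x₀ κ u := by
  filter_upwards [eventually_ge_atTop (2 : ℝ), eventually_ge_atTop (2 * c₃ / c₂),
    eventually_gt_atTop (2 * (2 + √(1 + c₁)) / c₂),
    eventually_ge_atTop (((√(1 + c₁) + c₃) / c₂ + 1) / κ),
    eventually_ge_atTop ((1 + x₀ + 1 / c₂) / κ)] with u h1 h2 h3 h4 h5
  have hu1 : 1 ≤ u := by linarith
  have hu0 : 0 < u := by linarith
  have hs : 0 ≤ √(1 + c₁) := Real.sqrt_nonneg _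
  rw [div_le_iff₀ hc₂] at h2
  rw [div_lt_iff₀ hc₂] at h3
  rw [div_le_iff₀ hκ] at h4 h5
  refine ⟨h1, ?_, ?_, ?_, ?_⟩
  · rw [← div_eq_mul_inv, div_le_iff₀ hu0]; linarith
  · have := mul_lt_mul_of_pos_right h3 hu0
    nlinarith
  · have p1 : u ^ 12 ≤ u ^ 19 := pow_le_pow_right₀ hu1 (by norm_num)
    have p2 : u ^ 4 ≤ u ^ 19 := pow_le_pow_right₀ hu1 (by norm_num)
    calc (√(1 + c₁) * u ^ 12 + c₃ * u ^ 4) / c₂ + u ^ 19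
        ≤ (√(1 + c₁) * u ^ 19 + c₃ * u ^ 19) / c₂ + u ^ 19 := by gcongr
      _ = ((√(1 + c₁) + c₃) / c₂ + 1) * u ^ 19 := by ring
      _ ≤ (u * κ) * u ^ 19 := by gcongr
      _ = κ * u ^ 20 := by ring
  · have p1 : 1 ≤ u ^ 12 := one_le_pow₀ hu1
    have p2 : u ^ 19 ≤ u ^ 20 := pow_le_pow_right₀ hu1 (by norm_num)
    have p3 : u ^ 18 ≤ u ^ 19 := pow_le_pow_right₀ hu1 (by norm_num)
    have hc : 0 < 1 / c₂ := by positivity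
    calc u ^ 6 * (u ^ 12 + x₀ + 1 / c₂)
        ≤ u ^ 6 * (u ^ 12 + x₀ * u ^ 12 + 1 / c₂ * u ^ 12) := by
          gcongr
          · exact le_mul_of_one_le_right hx₀.le p1
          · exact le_mul_of_one_le_right hc.le p1
      _ = (1 + x₀ + 1 / c₂) * u ^ 18 := by ring
      _ ≤ (1 + x₀ + 1 / c₂) * u ^ 19 := by gcongr
      _ ≤ (u * κ) * u ^ 19 := by gcongr
      _ = κ * u ^ 20 := by ring

/-- Bound for the remainder of a window in terms of the observations' size and of the centred
counts on a grid around the quantile of the mixture. -/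
theorem abs_mul_remainder_le_of_scale [IsProbabilityMeasure P]
    (hM : IsPiecewiseStationary P n k Y X) (hD : DensityCondition P q Y f c₁ c₂ c₃)
    (hc₁ : 0 < c₁) (hc₂ : 0 < c₂) (hc₃ : 0 < c₃) (hq : q ∈ Set.Ioo (0 : ℝ) 1)
    (ha : 1 ≤ a) (hab : a < b) (hb : b ≤ n) {x₀ κ u θ δ : ℝ} {K : ℕ}
    (hu : ScaleCondition c₁ c₂ c₃ x₀ κ u) (hun : u ^ 40 = n)
    (hθ : θ = quantile q (mixture (weight k a b) (segCDF P Y))) (hx₀ : |θ| ≤ x₀)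
    (hδ : δ = u ^ 2 / √((b : ℝ) - a + 1)) (hK : u ^ 3 ≤ K) {ω : Ω}
    (h₀ : ∀ t ∈ Finset.Icc a b, |X t ω| ≤ u ^ 12)
    (h₁ : |centeredCount P X a b (Set.Iic θ) ω| ≤ u * √(1 + ((b : ℝ) - a + 1) * 1))
    (h₂ : ∀ j ≤ 2 * K, |centeredCount P X a b (Set.uIoc θ (θ - δ + j * (δ / K))) ω| ≤
      u * √(1 + ((b : ℝ) - a + 1) * (c₁ * δ))) :
    |((b : ℝ) - a + 1) * remainder q k (segCDF P Y) f (fun t => X t ω) a b| ≤ κ * u ^ 20 := by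
  have hN := window_length_pos hab
  have hw := hM.isWeight ha hab hb
  obtain ⟨hG, hg⟩ := hD.quantile_mixture hM.measurable hq hw
  have hu2 := hu.two_le
  have hu0 : 0 < u := by linarith
  have hu1 : 1 ≤ u := by linarith
  set N : ℝ := (b : ℝ) - a + 1 with hNdef
  have hN0 : 0 < N := by linarith
  have hx0nn : 0 ≤ x₀ := (abs_nonneg _).trans hx₀
  -- In short windows `δ` need not be small, so only the crude size bound is used.
  rcases le_or_gt N (u ^ 6) with hsmall | hlarge
  · rw [hθ] at hx₀
    refine (hM.abs_mul_remainder_le ha hab hb hq hc₂ h₀ hx₀ hG hg).trans (le_trans ?_ hu.short)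
    exact mul_le_mul_of_nonneg_right hsmall (by positivity)
  rw [← hθ] at hG hg
  set s := √N with hs
  have hss : s ^ 2 = N := Real.sq_sqrt hN0.le
  have hs0 : 0 < s := Real.sqrt_pos.mpr hN0
  have hs1 : 1 ≤ s := Real.one_le_sqrt.mpr hN
  have hs3 : u ^ 3 ≤ s := Real.le_sqrt_of_sq_le (by rw [← pow_mul]; exact hlarge.le)
  have hsn : s ≤ u ^ 20 := by
    refine Real.sqrt_le_iff.mpr ⟨by positivity, ?_⟩
    rw [← pow_mul, hun, hNdef]
    have h1 : (b : ℝ) ≤ n := by exact_mod_cast hb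
    have h2 : (1 : ℝ) ≤ a := by exact_mod_cast ha
    linarith
  have hδ0 : 0 < δ := by rw [hδ]; positivity
  have hδu : δ ≤ u⁻¹ := by
    rw [hδ, div_le_iff₀ hs0]
    calc u ^ 2 = u⁻¹ * u ^ 3 := by field_simp
      _ ≤ u⁻¹ * s := by gcongr
  have hδ1 : δ ≤ 1 := hδu.trans (inv_le_one_of_one_le₀ hu1)
  have hNδ : N * δ = s * u ^ 2 := by rw [hδ, ← hss]; field_simp
  have hNδ2 : N * δ ^ 2 = u ^ 4 := by rw [hδ, ← hss]; field_simp
  have hK1 : 1 ≤ K := by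
    have : (1 : ℝ) ≤ K := (one_le_pow₀ hu1).trans hK
    exact_mod_cast this
  have hK0 : (0 : ℝ) < K := by exact_mod_cast hK1
  set r := √(1 + c₁) with hr
  have hr0 : 0 < r := Real.sqrt_pos.mpr (by linarith)
  have hrr : r ^ 2 = 1 + c₁ := Real.sq_sqrt (by linarith)
  have e1 : √(1 + N * 1) ≤ 2 * s := by
    refine Real.sqrt_le_iff.mpr ⟨by positivity, ?_⟩
    rw [mul_pow, hss]; linarith
  -- Two bounds on the same oscillation: this one scales with `√N`, as the separation condition
  -- requires; `e3` is uniform in `N` and enters the final error.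
  have e2 : √(1 + N * (c₁ * δ)) ≤ r * s := by
    refine Real.sqrt_le_iff.mpr ⟨by positivity, ?_⟩
    rw [mul_pow, hss, hrr]
    have : N * (c₁ * δ) ≤ N * c₁ := by
      refine mul_le_mul_of_nonneg_left (mul_le_of_le_one_right hc₁.le hδ1) hN0.le
    linarith
  have e3 : √(1 + N * (c₁ * δ)) ≤ r * u ^ 11 := by
    refine Real.sqrt_le_iff.mpr ⟨by positivity, ?_⟩
    have h1 : N * (c₁ * δ) ≤ c₁ * u ^ 22 := by
      calc N * (c₁ * δ) = c₁ * (s * u ^ 2) := by rw [← hNδ]; ring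
        _ ≤ c₁ * (u ^ 20 * u ^ 2) := by gcongr
        _ = c₁ * u ^ 22 := by ring
    have h2 : 1 ≤ u ^ 22 := one_le_pow₀ hu1
    rw [mul_pow, hrr, ← pow_mul, show 11 * 2 = 22 by norm_num]
    linarith
  rw [hM.mul_remainder ha hab hb, ← hθ, ← hNdef]
  have hX : ∀ t ∈ Finset.Icc a b, Measurable (X t) := fun t ht =>
    hM.measurable_data t (ha.trans (Finset.mem_Icc.mp ht).1) ((Finset.mem_Icc.mp ht).2.trans hb)
  refine (abs_bahadur_le (c₂ := c₂) (c₃ := c₃) (δ := δ) (s₁ := u * √(1 + N * 1))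
    (s₂ := u * √(1 + N * (c₁ * δ))) hK1 hc₂ hc₃.le hδ0 hN0
    (fun _ => hasDerivAt_mixture fun i => hD.hasDerivAt_segCDF hM.measurable i _)
    (fun x y => hw.abs_mixture_sub_le fun i => hD.abs_sub_le i x y) hG hg ?_
    (monotone_empiricalCDF hab _) ?_ ?_ ?_).trans ?_
  · exact (mul_le_mul_of_nonneg_left hδu hc₃.le).trans hu.spread
  · rw [hNdef, ← hM.centeredCount_Iic ha hab hb]
    exact h₁
  · intro j hj
    rw [hNdef, ← hM.centeredCount_Iic ha hab hb, ← hM.centeredCount_Iic ha hab hb,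
      abs_centeredCount_Iic_sub hX]
    exact h₂ j hj
  · calc u * √(1 + N * 1) + u * √(1 + N * (c₁ * δ)) ≤ u * (2 * s) + u * (r * s) := by gcongr
      _ = (2 + r) * u * s := by ring
      _ < c₂ / 2 * u ^ 2 * s := mul_lt_mul_of_pos_right hu.separation hs0
      _ = c₂ / 2 * (N * δ) := by rw [hNδ]; ring
      _ = N * (c₂ / 2 * δ) := by ring
  · refine le_trans ?_ hu.long
    rw [hNδ2, hNδ]
    have h1 : u * √(1 + N * (c₁ * δ)) ≤ r * u ^ 12 := by
      calc u * √(1 + N * (c₁ * δ)) ≤ u * (r * u ^ 11) := by gcongr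
        _ = r * u ^ 12 := by ring
    have h2 : s * u ^ 2 / K ≤ u ^ 19 := by
      rw [div_le_iff₀ hK0]
      calc s * u ^ 2 ≤ u ^ 20 * u ^ 2 := by gcongr
        _ = u ^ 19 * u ^ 3 := by ring
        _ ≤ u ^ 19 * K := by gcongr
    gcongr

/-- Probability that the largest remainder exceeds `κ √n`, for a sample size `n` at which the scale
conditions and the tail bounds for the centred counts hold. -/
theorem measureReal_supRemainder_le [IsProbabilityMeasure P]
    (hM : IsPiecewiseStationary P n k Y X) (hD : DensityCondition P q Y f c₁ c₂ c₃)
    (hT : TailCondition P Y C lam)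
    (hc₁ : 0 < c₁) (hc₂ : 0 < c₂) (hc₃ : 0 < c₃) (hq : q ∈ Set.Ioo (0 : ℝ) 1) {x₀ κ u : ℝ}
    (hκ : 0 < κ) (hu : ScaleCondition c₁ c₂ c₃ x₀ κ u) (hun : u ^ 40 = n)
    (hx₀ : ∀ w : Fin (m + 1) → ℝ, IsWeight w → |quantile q (mixture w (segCDF P Y))| ≤ x₀)
    (hconc : ∀ a b : ℕ, 1 ≤ a → a ≤ b → b ≤ n → ∀ I : Set ℝ, MeasurableSet I → ∀ v : ℝ, 0 ≤ v →
      (∀ t, 1 ≤ t → t ≤ n → P.real (X t ⁻¹' I) ≤ v) →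
      P.real {ω | u * √(1 + ((b : ℝ) - a + 1) * v) < |centeredCount P X a b I ω|} ≤
        ((n : ℝ) ^ 4)⁻¹) :
    P.real {ω | κ * √n < |supRemainder q n k (segCDF P Y) f (fun t => X t ω)|} ≤
      n * (C * (u ^ 12) ^ (-lam)) + (n : ℝ)⁻¹ := by
  have hu2 := hu.two_le
  have hu0 : 0 < u := by linarith
  have hu1 : 1 ≤ u := by linarith
  have hsqrt : √(n : ℝ) = u ^ 20 := by
    rw [← hun, show 40 = 20 * 2 by norm_num, pow_mul, Real.sqrt_sq (by positivity)]
  have hn0 : (0 : ℝ) < n := by rw [← hun]; positivity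
  set K : ℕ := ⌈u ^ 3⌉₊ with hK
  have hKu : u ^ 3 ≤ K := Nat.le_ceil _
  -- Each window involves `2 K + 2` sets: the half-line at `θ` and one interval for each of the `2 K
  -- + 1` grid points.
  have hKn : ((2 * K + 2 : ℕ) : ℝ) ≤ n := by
    have h1 := Nat.ceil_lt_add_one (by positivity : 0 ≤ u ^ 3)
    have h2 : u ^ 5 ≤ u ^ 40 := pow_le_pow_right₀ hu1 (by norm_num)
    have h3 : 8 ≤ u ^ 3 := by
      calc (8 : ℝ) = 2 ^ 3 := by norm_num
        _ ≤ u ^ 3 := by gcongr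
    have h4 : 4 * u ^ 3 ≤ u ^ 5 := by
      calc 4 * u ^ 3 = 2 ^ 2 * u ^ 3 := by norm_num
        _ ≤ u ^ 2 * u ^ 3 := by gcongr
        _ = u ^ 5 := by ring
    rw [← hun]
    push_cast
    linarith
  set θ : ℕ × ℕ → ℝ := fun p => quantile q (mixture (weight k p.1 p.2) (segCDF P Y)) with hθ
  set δ : ℕ × ℕ → ℝ := fun p => u ^ 2 / √((p.2 : ℝ) - p.1 + 1) with hδ
  set W : Finset (ℕ × ℕ) := ((Finset.Icc 1 n) ×ˢ (Finset.Icc 1 n)).filter fun p => p.1 < p.2 with hW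
  have hWmem : ∀ p ∈ W, 1 ≤ p.1 ∧ p.1 < p.2 ∧ p.2 ≤ n := by
    intro p hp
    simp only [hW, Finset.mem_filter, Finset.mem_product, Finset.mem_Icc] at hp
    omega
  have hWcard : (W.card : ℝ) ≤ n * n := by
    have := (Finset.card_filter_le ((Finset.Icc 1 n) ×ˢ (Finset.Icc 1 n)) fun p => p.1 < p.2)
    rw [Finset.card_product, Nat.card_Icc, Nat.add_sub_cancel] at this
    exact_mod_cast this
  set E₀ : Set Ω := ⋃ t ∈ Finset.Icc 1 n, {ω | u ^ 12 < |X t ω|} with hE₀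
  set E₁ : ℕ × ℕ → Set Ω := fun p => {ω | u * √(1 + ((p.2 : ℝ) - p.1 + 1) * 1) <
    |centeredCount P X p.1 p.2 (Set.Iic (θ p)) ω|} with hE₁
  set E₂ : ℕ × ℕ → ℕ → Set Ω := fun p j => {ω | u * √(1 + ((p.2 : ℝ) - p.1 + 1) * (c₁ * δ p)) <
    |centeredCount P X p.1 p.2 (Set.uIoc (θ p) (θ p - δ p + j * (δ p / K))) ω|} with hE₂
  have hsub : {ω | κ * √n < |supRemainder q n k (segCDF P Y) f (fun t => X t ω)|} ⊆
      E₀ ∪ ⋃ p ∈ W, (E₁ p ∪ ⋃ j ∈ Finset.range (2 * K + 1), E₂ p j) := by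
    intro ω hω
    by_contra hcon
    simp only [hE₀, hE₁, hE₂, Set.mem_union, Set.mem_iUnion, not_or, not_exists, Set.mem_ofPred_eq,
      not_lt, Finset.mem_range] at hcon hω
    obtain ⟨g₀, g₁⟩ := hcon
    refine absurd hω (not_lt.mpr ?_)
    rw [supRemainder, abs_of_nonneg (Real.iSup_nonneg fun _ => abs_nonneg _), hsqrt]
    -- Nonnegativity of the bound covers `n < 2`, where there is no window and the supremum is `0`.
    refine Real.iSup_le (fun p => ?_) (by positivity)
    obtain ⟨⟨a, b⟩, ha, hab, hb⟩ := p
    have hp : (a, b) ∈ W := by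
      simp only [hW, Finset.mem_filter, Finset.mem_product, Finset.mem_Icc]
      simp only at ha hab hb
      omega
    obtain ⟨g₂, g₃⟩ := g₁ (a, b) hp
    refine abs_mul_remainder_le_of_scale hM hD hc₁ hc₂ hc₃ hq ha hab hb (θ := θ (a, b))
      (δ := δ (a, b)) (K := K) hu hun rfl (hx₀ _ (hM.isWeight ha hab hb)) rfl hKu ?_ g₂ ?_
    · intro t ht
      have ht := Finset.mem_Icc.mp ht
      exact g₀ t (Finset.mem_Icc.mpr ⟨ha.trans ht.1, ht.2.trans hb⟩)
    · intro j hj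
      exact g₃ j (by omega)
  have hP₀ : P.real E₀ ≤ n * (C * (u ^ 12) ^ (-lam)) := by
    refine (measureReal_biUnion_finset_le _ _).trans ?_
    refine (Finset.sum_le_sum (g := fun _ => C * (u ^ 12) ^ (-lam)) fun t ht => ?_).trans (by simp)
    have ht := Finset.mem_Icc.mp ht
    obtain ⟨i, -, -, hi⟩ := hM.exists_eq ht.1 ht.2
    rw [hi]
    exact hT i t _ (by positivity)
  have hP₁ : ∀ p ∈ W, P.real (E₁ p ∪ ⋃ j ∈ Finset.range (2 * K + 1), E₂ p j) ≤
      n * ((n : ℝ) ^ 4)⁻¹ := by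
    intro p hp
    obtain ⟨ha, hab, hb⟩ := hWmem p hp
    have hN := window_length_pos hab
    have hδ0 : 0 < δ p := by
      have : 0 < √((p.2 : ℝ) - p.1 + 1) := Real.sqrt_pos.mpr (by linarith)
      simp only [hδ]; positivity
    have b1 : P.real (E₁ p) ≤ ((n : ℝ) ^ 4)⁻¹ := hconc p.1 p.2 ha hab.le hb _ measurableSet_Iic 1
      zero_le_one fun t _ _ => measureReal_le_one
    have b2 : ∀ j ∈ Finset.range (2 * K + 1), P.real (E₂ p j) ≤ ((n : ℝ) ^ 4)⁻¹ := by
      intro j hj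
      refine hconc p.1 p.2 ha hab.le hb _ measurableSet_uIoc (c₁ * δ p) (by positivity)
        fun t h1 h2 => (hM.measureReal_uIoc_le hD _ _ t h1 h2).trans ?_
      refine mul_le_mul_of_nonneg_left ?_ hc₁.le
      have hK0 : (0 : ℝ) < K := lt_of_lt_of_le (by positivity) hKu
      have hj2 : (j : ℝ) ≤ 2 * K := by
        have := Finset.mem_range.mp hj
        exact_mod_cast (by omega : j ≤ 2 * K)
      have h3 : (j : ℝ) * (δ p / K) ≤ 2 * δ p := by
        calc (j : ℝ) * (δ p / K) ≤ 2 * K * (δ p / K) := by gcongr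
          _ = 2 * δ p := by field_simp
      have h4 : 0 ≤ (j : ℝ) * (δ p / K) := by positivity
      rw [abs_le]; constructor <;> linarith
    have b3 := (measureReal_biUnion_finset_le (μ := P) (Finset.range (2 * K + 1)) (E₂ p)).trans
      (Finset.sum_le_sum b2)
    rw [Finset.sum_const, Finset.card_range, nsmul_eq_mul] at b3
    refine (measureReal_union_le _ _).trans ((add_le_add b1 b3).trans ?_)
    calc _ = ((2 * K + 2 : ℕ) : ℝ) * ((n : ℝ) ^ 4)⁻¹ := by push_cast; ring
      _ ≤ _ := by gcongr
  refine (measureReal_mono hsub (measure_ne_top _ _)).trans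
    ((measureReal_union_le _ _).trans (add_le_add hP₀ ?_))
  refine (measureReal_biUnion_finset_le _ _).trans ((Finset.sum_le_sum hP₁).trans ?_)
  rw [Finset.sum_const, nsmul_eq_mul]
  calc (W.card : ℝ) * (n * ((n : ℝ) ^ 4)⁻¹) ≤ n * n * (n * ((n : ℝ) ^ 4)⁻¹) := by gcongr
    _ = (n : ℝ)⁻¹ := by field_simp

end Model

end QuantileCP

/-! ### Gâteaux derivative and uniform remainder bound. -/

theorem theoremS2
    (m : ℕ) (q : ℝ) (hq : q ∈ Set.Ioo (0 : ℝ) 1)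
    (c₀ c₁ c₂ c₃ C lam : ℝ) (hc₀ : 0 < c₀) (hc₁ : 0 < c₁) (hc₂ : 0 < c₂) (hc₃ : 0 < c₃)
    (hC : 0 < C) (hlam : 18 / 5 < lam)
    (Ω : ℕ → Type*) [∀ n, MeasurableSpace (Ω n)]
    (P : ∀ n, Measure (Ω n)) [∀ n, IsProbabilityMeasure (P n)]
    (k : ∀ _n : ℕ, Fin (m + 2) → ℕ)
    (Y : ∀ n, Fin (m + 1) → ℤ → Ω n → ℝ)
    (X : ∀ n, ℕ → Ω n → ℝ)
    (f : ∀ _n : ℕ, Fin (m + 1) → ℝ → ℝ)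
    (hmodel : ∀ᶠ n in atTop, QuantileCP.IsPiecewiseStationary (P n) n (k n) (Y n) (X n))
    (hmix : ∀ᶠ n in atTop, ∀ l : ℕ, 1 ≤ l →
      QuantileCP.alphaCoef (P n) (X n) n l ≤ Real.exp (-c₀ * l))
    (hdens : ∀ᶠ n in atTop, QuantileCP.DensityCondition (P n) q (Y n) (f n) c₁ c₂ c₃)
    (htail : ∀ᶠ n in atTop, QuantileCP.TailCondition (P n) (Y n) C lam) :
    (∀ᶠ n in atTop, ∀ a b : ℕ, 1 ≤ a → a < b → b ≤ n → ∀ (i : Fin (m + 1)) (y : ℝ),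
      y ≠ QuantileCP.quantile q
        (QuantileCP.mixture (QuantileCP.weight (k n) a b) (QuantileCP.segCDF (P n) (Y n))) →
      QuantileCP.IsGateauxDeriv q (QuantileCP.segCDF (P n) (Y n)) (QuantileCP.weight (k n) a b) i y
        (QuantileCP.partialInfluence q (QuantileCP.segCDF (P n) (Y n)) (f n)
          (QuantileCP.weight (k n) a b) i y)) ∧
    QuantileCP.IsLittleOp P
      (fun n ω => QuantileCP.supRemainder q n (k n) (QuantileCP.segCDF (P n) (Y n)) (f n)
        (fun t => X n t ω))
      (fun n => Real.sqrt n) := by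
  refine ⟨?_, ?_⟩
  · filter_upwards [hmodel, hdens] with n hM hD
    intro a b ha hab hb i y hy
    exact hD.isGateauxDeriv hc₁ hc₂ hc₃ hM.measurable hq (hM.isWeight ha hab hb) i hy
  intro κ hκ
  obtain ⟨x₀, hx₀, hquant⟩ :=
    QuantileCP.exists_abs_quantile_mixture_le (C := C) m hq (by linarith : 0 < lam)
  have hcast : Tendsto (fun n : ℕ => (n : ℝ)) atTop atTop := tendsto_natCast_atTop_atTop
  have hscale : ∀ᶠ n : ℕ in atTop,
      QuantileCP.ScaleCondition c₁ c₂ c₃ x₀ κ ((n : ℝ) ^ (1 / 40 : ℝ)) := ((tendsto_rpow_atTop (by norm_num : (0 : ℝ) < 1 / 40)).comp hcast).eventually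
    (QuantileCP.eventually_scaleCondition (c₁ := c₁) hc₂ hc₃ hx₀ hκ)
  -- The power `4` pays for at most `n²` windows with at most `n` sets each and leaves `1 / n`.
  have hconc := QuantileCP.eventually_centeredCount_tail hc₀ (by norm_num : (0 : ℝ) < 1 / 40) 4
  have hbound : ∀ᶠ n : ℕ in atTop, P n {ω | κ * √n < |QuantileCP.supRemainder q n (k n)
      (QuantileCP.segCDF (P n) (Y n)) (f n) (fun t => X n t ω)|} ≤
      ENNReal.ofReal (C * (n : ℝ) ^ (-(3 / 10 * lam - 1)) + (n : ℝ)⁻¹) := by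
    filter_upwards [hmodel, hmix, hdens, htail, hscale, hconc, eventually_gt_atTop 0]
      with n hM hX hD hT hu hc hn
    have hn0 : (0 : ℝ) < n := by exact_mod_cast hn
    have hun : ((n : ℝ) ^ (1 / 40 : ℝ)) ^ 40 = n := by
      rw [← Real.rpow_natCast, ← Real.rpow_mul hn0.le]
      norm_num
    have hn4 : (n : ℝ) ^ (-4 : ℝ) = ((n : ℝ) ^ 4)⁻¹ := by
      rw [Real.rpow_neg hn0.le]
      norm_cast
    have h := QuantileCP.measureReal_supRemainder_le hM hD hT hc₁ hc₂ hc₃ hq hκ hu hun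
      (fun w hw => hquant (P n) (Y n) hM.measurable hT w hw)
      (fun a b ha hab hb I hI v hv0 hv => by
        rw [← hn4]
        exact hc (P n) (X n) hM.measurable_data hX a b ha hab hb I hI v hv0 hv)
    rw [← ofReal_measureReal]
    refine ENNReal.ofReal_le_ofReal (h.trans (le_of_eq ?_))
    congr 1
    rw [← Real.rpow_natCast, ← Real.rpow_mul hn0.le, ← Real.rpow_mul hn0.le, mul_left_comm]
    nth_rewrite 1 [← Real.rpow_one (n : ℝ)]
    rw [← Real.rpow_add hn0]
    congr 2
    push_cast
    ring
  refine tendsto_of_tendsto_of_tendsto_of_le_of_le' tendsto_const_nhds ?_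
    (Eventually.of_forall fun n => zero_le) hbound
  rw [← ENNReal.ofReal_zero]
  refine ENNReal.tendsto_ofReal ?_
  -- The exponent is positive as soon as `lam > 10 / 3`, which `18 / 5 < lam` ensures.
  have h1 := ((tendsto_rpow_neg_atTop (by linarith : 0 < 3 / 10 * lam - 1)).comp hcast).const_mul C
  have h2 := tendsto_inv_atTop_zero.comp hcast
  simpa using h1.add h2
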